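/- Let $k$ be an algebraically closed field of characteristic $0$, let $E$ be an elliptic curve over $k$ and let $K=k(E)$ be its field of rational functions. The pre-Bloch group $B_2(K)$ is the quotient of the free abelian group $\mathbb Z[K\setminus\{0,1\}]$, with generators $[f]$ for $f\in K\setminus\{0,1\}$, by the subgroup generated by the Abel five-term elements $$[x]-[y]+[y/x]+\left[\frac{1-x}{1-y}\right]-\left[\frac{1-x^{-1}}{1-y^{-1}}\right],\qquad x,y\in K\setminus\{0,1\},\ x\neq y.$$ The degree $\deg f$ of a non-zero $f\in K$ is the number of zeros of $f$ on $E$ counted with multiplicity (so non-zero constants have degree $0$), and $\mathcal F_nB_2(K)$ is the subgroup of $B_2(K)$ generated by the classes $[f]$ with $f \in K\setminus\{0,1\}$ and $\deg f\le n$. A function $f\in K\setminus\{0,1\}$ is called generic if there are points $\alpha_1,\alpha_2\in f^{-1}(0)$, $\beta_1,\beta_2\in f^{-1}(1)$, $\gamma_1,\gamma_2\in f^{-1}(\infty)$ of $E$ such that 1. if $\alpha_1=\alpha_2$, then $f$ has a zero of multiplicity at least $2$ at $\alpha_1$, and if $\gamma_1=\gamma_2$, then $f$ has a pole of multiplicity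 at least $2$ at $\gamma_1$; 2. $\beta_1\ne\beta_2$; 3. the points $\alpha_1+\alpha_2$, $\beta_1+\beta_2$, $\gamma_1+\gamma_2$ are pairwise distinct; 4. the points $\alpha_1+\alpha_2-\gamma_1-\beta_1$ and $\alpha_1+\alpha_2-\gamma_1-\beta_2$ are non-zero. Then for every integer $n\ge 3$ the group $\mathcal F_{n+1}B_2(K)$ is generated by the subgroup $\mathcal F_nB_2(K)$ together with the classes $[f]$ of the generic functions $f$ of degree $n+1$. -/

import Mathlib

/-! ### The pre-Bloch group of a field -/

/-- The set `F \ {0, 1}` indexing the generators of the pre-Bloch group of `F`. -/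
abbrev PreBlochGen (F : Type*) [Field F] : Type _ := {f : F // f ≠ 0 ∧ f ≠ 1}

namespace PreBlochGen

variable {F : Type*} [Field F]

/-- The element `y / x` of `F \ {0, 1}`, for distinct `x, y` in `F \ {0, 1}`. -/
def quot (x y : PreBlochGen F) (h : x ≠ y) : PreBlochGen F :=
  ⟨y.1 / x.1, div_ne_zero y.2.1 x.2.1, fun e =>
    h (Subtype.ext (eq_of_div_eq_one e).symm)⟩

/-- The element `(1 - x) / (1 - y)` of `F \ {0, 1}`, for distinct `x, y` in `F \ {0, 1}`. -/
def oneSubQuot (x y : PreBlochGen F) (h : x ≠ y) : PreBlochGen F :=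
  ⟨(1 - x.1) / (1 - y.1),
    div_ne_zero (sub_ne_zero.2 x.2.2.symm) (sub_ne_zero.2 y.2.2.symm), fun e =>
      h (Subtype.ext (sub_right_injective (eq_of_div_eq_one e)))⟩

/-- The element `(1 - x⁻¹) / (1 - y⁻¹)` of `F \ {0, 1}`, for distinct `x, y` in `F \ {0, 1}`. -/
def oneSubInvQuot (x y : PreBlochGen F) (h : x ≠ y) : PreBlochGen F :=
  ⟨(1 - x.1⁻¹) / (1 - y.1⁻¹),
    div_ne_zero (sub_ne_zero.2 fun e => x.2.2 (inv_eq_one.1 e.symm))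
      (sub_ne_zero.2 fun e => y.2.2 (inv_eq_one.1 e.symm)), fun e =>
      h (Subtype.ext (inv_injective (sub_right_injective (eq_of_div_eq_one e))))⟩

/-- The Abel five-term element
`[x] - [y] + [y / x] + [(1 - x) / (1 - y)] - [(1 - x⁻¹) / (1 - y⁻¹)]`. -/
def fiveTerm (x y : PreBlochGen F) (h : x ≠ y) : FreeAbelianGroup (PreBlochGen F) :=
  FreeAbelianGroup.of x - FreeAbelianGroup.of y + FreeAbelianGroup.of (quot x y h)
    + FreeAbelianGroup.of (oneSubQuot x y h) - FreeAbelianGroup.of (oneSubInvQuot x y h)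

end PreBlochGen

/-- The subgroup of `ℤ[F \ {0, 1}]` generated by the Abel five-term elements. -/
def fiveTermSubgroup (F : Type*) [Field F] : AddSubgroup (FreeAbelianGroup (PreBlochGen F)) :=
  AddSubgroup.closure {r | ∃ (x y : PreBlochGen F) (h : x ≠ y), r = PreBlochGen.fiveTerm x y h}

/-- The pre-Bloch group `B₂(F)`. -/
abbrev PreBloch (F : Type*) [Field F] : Type _ :=
  FreeAbelianGroup (PreBlochGen F) ⧸ fiveTermSubgroup F

/-- The class `[f]` in `B₂(F)` of an element `f` of `F \ {0, 1}`. -/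
def PreBloch.symbol {F : Type*} [Field F] (f : PreBlochGen F) : PreBloch F :=
  QuotientAddGroup.mk' (fiveTermSubgroup F) (FreeAbelianGroup.of f)

/-! ### Rational functions on an elliptic curve -/

namespace EllipticFunction

open WeierstrassCurve

noncomputable section

variable {k : Type*} [Field k] (E : WeierstrassCurve k)

/-- The rational function `x` on `E`. -/
def xFun : E.toAffine.FunctionField :=
  algebraMap E.toAffine.CoordinateRing E.toAffine.FunctionField
    (Affine.CoordinateRing.mk E.toAffine (Polynomial.C Polynomial.X))

/-- The rational function `y` on `E`. -/
def yFun : E.toAffine.FunctionField :=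
  algebraMap E.toAffine.CoordinateRing E.toAffine.FunctionField
    (Affine.CoordinateRing.mk E.toAffine Polynomial.X)

/-- Affine coordinate functions on `E` in a chart of the projective plane around the point `P`,
both vanishing at `P`: these are `x - a` and `y - b` at the affine point `P = (a, b)`, and
`X / Y = x / y` and `Z / Y = 1 / y` at the point at infinity `[0 : 1 : 0]`. -/
def chart : E.toAffine.Point → Fin 2 → E.toAffine.FunctionField
  | .zero => ![xFun E / yFun E, 1 / yFun E]
  | .some a b _ => ![xFun E - algebraMap k _ a, yFun E - algebraMap k _ b]

variable {E}

/-- The `n`-th power `𝔪 ^ n` of the maximal ideal `𝔪` of the local ring of `E` at `P`, as a subset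
of the function field. The local ring consists of the fractions `g / h` of polynomials in the
coordinate functions at `P`, with `h` not vanishing at `P`; its maximal ideal is generated by these
coordinate functions. For `n = 0` this is the local ring itself. -/
def maxIdealPow (P : E.toAffine.Point) (n : ℕ) : Set E.toAffine.FunctionField :=
  {f | ∃ g h : MvPolynomial (Fin 2) k,
    g ∈ (Ideal.span {MvPolynomial.X 0, MvPolynomial.X 1} : Ideal (MvPolynomial (Fin 2) k)) ^ n ∧
    MvPolynomial.constantCoeff h ≠ 0 ∧
    f = MvPolynomial.aeval (chart E P) g / MvPolynomial.aeval (chart E P) h}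

/-- The multiplicity of `P` as a zero of a non-zero rational function `f`: the largest `n` with
`f ∈ 𝔪 ^ n`. It is `0` if `f` has a pole at `P`, or is regular and non-zero there. -/
def zeroMult (f : E.toAffine.FunctionField) (P : E.toAffine.Point) : ℕ :=
  sSup {n : ℕ | f ∈ maxIdealPow P n}

/-- The multiplicity of `P` as a pole of a non-zero rational function `f`. -/
def poleMult (f : E.toAffine.FunctionField) (P : E.toAffine.Point) : ℕ :=
  zeroMult f⁻¹ P

/-- The degree of a non-zero rational function: the number of its zeros on `E`, the point at
infinity included, counted with multiplicity. -/
def degree (f : E.toAffine.FunctionField) : ℕ :=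
  ∑ᶠ P : E.toAffine.Point, zeroMult f P

/-- Generic rational functions `f` on `E` (for `f ≠ 0, 1`). The points `α₁, α₂` are zeros of `f`,
`β₁, β₂` are zeros of `f - 1`, and `γ₁, γ₂` are poles of `f`. -/
def IsGeneric [DecidableEq k] (f : E.toAffine.FunctionField) : Prop :=
  ∃ α₁ α₂ β₁ β₂ γ₁ γ₂ : E.toAffine.Point,
    (0 < zeroMult f α₁ ∧ 0 < zeroMult f α₂) ∧
    (0 < zeroMult (f - 1) β₁ ∧ 0 < zeroMult (f - 1) β₂) ∧
    (0 < poleMult f γ₁ ∧ 0 < poleMult f γ₂) ∧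
    ((α₁ = α₂ → 2 ≤ zeroMult f α₁) ∧ (γ₁ = γ₂ → 2 ≤ poleMult f γ₁)) ∧
    β₁ ≠ β₂ ∧
    (α₁ + α₂ ≠ β₁ + β₂ ∧ β₁ + β₂ ≠ γ₁ + γ₂ ∧ α₁ + α₂ ≠ γ₁ + γ₂) ∧
    (α₁ + α₂ - γ₁ - β₁ ≠ 0 ∧ α₁ + α₂ - γ₁ - β₂ ≠ 0)

variable (E)

/-- The subgroup `𝓕ₙ B₂(K)` of the pre-Bloch group of the function field `K` of `E` generated by
the classes `[f]` with `deg f ≤ n`. -/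
def filtration (n : ℕ) : AddSubgroup (PreBloch E.toAffine.FunctionField) :=
  AddSubgroup.closure
    {b | ∃ f : PreBlochGen E.toAffine.FunctionField, degree f.1 ≤ n ∧ b = PreBloch.symbol f}

/-- The subgroup of the pre-Bloch group generated by the classes `[f]` of generic functions of
degree `n`. -/
def genericSubgroup [DecidableEq k] (n : ℕ) : AddSubgroup (PreBloch E.toAffine.FunctionField) :=
  AddSubgroup.closure
    {b | ∃ f : PreBlochGen E.toAffine.FunctionField,
      IsGeneric f.1 ∧ degree f.1 = n ∧ b = PreBloch.symbol f}

end

end EllipticFunction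

/-! Let `f` have degree n + 1 and let `c` be a constant other than 0 and 1. The five-term relation
for x = f, y = c expresses [f] through [c], which has degree 0, and the classes of c/f, (1 - f)/(1 -
c) and (1 - f⁻¹)/(1 - c⁻¹). These three functions again have degree n + 1, their zeros and poles lie
over the values 0, 1, ∞ of `f`, and each equals 1 on the fibre f⁻¹(c). Since `f` has finitely many
ramification points and finitely many points α₁ + α₂ - γ arise from these zeros and poles, a
suitable `c` has a fibre of n + 1 ≥ 4 distinct points avoiding all of them. Four points leave enough
room to choose β₁, β₂, so each of the three functions h is generic unless α₁ + α₂ = γ₁ + γ₂ for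
every pair of zeros and every pair of poles (`isGeneric_of_isZeroPair`).

In the exceptional case h has a single zero α and a single pole γ, with 2α = 2γ
(`exists_unique_zero`). Then 2α - 2γ is the divisor of a function, so h = e ^ (m + 1) with m ≥ 1
(`exists_eq_pow`). The five-term relation for e and e ^ (m + 1) involves only e, e ^ m and inverses
of geometric sums, all of degree at most m · deg e ≤ n (`symbol_pow_mem`). The two reductions meet
in `symbol_mem_sup` and `symbol_mem_of_degree_eq`.

The supporting facts about the curve are obtained from the explicit local rings: they are discrete
valuation rings (`exists_valuation_of_chart`), principal divisors have degree zero (`finsum_ord`, by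
taking norms to k(x)), ramification is finite (`finite_ramification`, by the invariant derivation in
characteristic 0), and 2α = 2γ yields a function by way of the ideal class group
(`exists_ord_eq_of_add_self_eq`). -/

open WithZero

/-! ### A discrete valuation from two local coordinates on a plane curve. -/

section Chart

open MvPolynomial

theorem MvPolynomial.sub_C_constantCoeff_mem {k : Type*} [CommRing k]
    (p : MvPolynomial (Fin 2) k) :
    p - C (constantCoeff p) ∈ (Ideal.span {X 0, X 1} : Ideal (MvPolynomial (Fin 2) k)) := by
  induction p using MvPolynomial.induction_on with
  | C a => simp
  | add p q hp hq =>
    have := Ideal.add_mem _ hp hq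
    simpa [add_sub_add_comm] using this
  | mul_X p i _ =>
    have hX : (X i : MvPolynomial (Fin 2) k) ∈
        (Ideal.span {X 0, X 1} : Ideal (MvPolynomial (Fin 2) k)) := by
      apply Ideal.subset_span
      fin_cases i <;> simp
    simpa using Ideal.mul_mem_left _ p hX

theorem MvPolynomial.constantCoeff_eq_zero_of_mem {k : Type*} [CommRing k]
    {p : MvPolynomial (Fin 2) k}
    (hp : p ∈ (Ideal.span {X 0, X 1} : Ideal (MvPolynomial (Fin 2) k))) :
    constantCoeff p = 0 := by
  have : (Ideal.span {X 0, X 1} : Ideal (MvPolynomial (Fin 2) k)) ≤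
      RingHom.ker (constantCoeff (σ := Fin 2) (R := k)) := by
    rw [Ideal.span_le]
    rintro x (rfl | rfl) <;> simp [RingHom.mem_ker]
  exact this hp

/-- The valuation attached to a pair of functions `c` which are coordinates around the smooth
point `(0, 0)` of a plane curve. -/
theorem exists_valuation_of_chart {k K : Type*} [Field k] [Field K] [Algebra k K] (c : Fin 2 → K)
    (h0 : ∀ h : MvPolynomial (Fin 2) k, aeval c h = 0 → constantCoeff h = 0)
    (i : Fin 2) (hi : c i ≠ 0)
    (h1 : ∀ j, ∃ u v : MvPolynomial (Fin 2) k,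
      constantCoeff u ≠ 0 ∧ aeval c u * c j = aeval c v * c i)
    (h2 : IntermediateField.adjoin k (Set.range c) = ⊤) :
    ∃ v : Valuation K ℤᵐ⁰, v (c i) = exp (-1 : ℤ) ∧ ∀ (n : ℕ) (f : K),
      v f ≤ exp (-(n : ℤ)) ↔ ∃ g h : MvPolynomial (Fin 2) k,
        g ∈ (Ideal.span {X 0, X 1} : Ideal (MvPolynomial (Fin 2) k)) ^ n ∧
        constantCoeff h ≠ 0 ∧ f = aeval c g / aeval c h := by
  let 𝔪 : Ideal (MvPolynomial (Fin 2) k) := RingHom.ker (constantCoeff (σ := Fin 2) (R := k))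
  have h𝔪 : 𝔪.IsPrime := RingHom.ker_isPrime _
  let φ : MvPolynomial (Fin 2) k →+* K := (aeval c : MvPolynomial (Fin 2) k →ₐ[k] K).toRingHom
  have hφ : ∀ y : 𝔪.primeCompl, IsUnit (φ y) := fun y =>
    isUnit_iff_ne_zero.2 fun e => y.2 (h0 _ e)
  -- By `h0` the polynomials that do not vanish at the origin are invertible in `K`. The local ring
  -- `O` is thus a quotient of the localization of the polynomial ring, and inherits being
  -- Noetherian and local.
  let ψ : Localization.AtPrime 𝔪 →+* K := IsLocalization.lift hφ
  let O : Subring K := ψ.range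
  have hO : ∀ f : K, f ∈ O ↔ ∃ g h : MvPolynomial (Fin 2) k,
      constantCoeff h ≠ 0 ∧ f = aeval c g / aeval c h := by
    intro f
    constructor
    · rintro ⟨z, rfl⟩
      obtain ⟨g, s, rfl⟩ := IsLocalization.exists_mk'_eq 𝔪.primeCompl z
      refine ⟨g, s, s.2, ?_⟩
      have hs : aeval c (s : MvPolynomial (Fin 2) k) ≠ 0 := fun e => s.2 (h0 _ e)
      rw [eq_div_iff hs, mul_comm]
      exact ((IsLocalization.lift_mk'_spec (hg := hφ) g _ s).1 rfl).symm
    · rintro ⟨g, h, hh, rfl⟩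
      have hs : aeval c h ≠ 0 := fun e => hh (h0 _ e)
      refine ⟨IsLocalization.mk' _ g (⟨h, hh⟩ : 𝔪.primeCompl), ?_⟩
      rw [eq_div_iff hs, mul_comm]
      exact ((IsLocalization.lift_mk'_spec (hg := hφ) g _ ⟨h, hh⟩).1 rfl).symm
  have : IsNoetherianRing (Localization.AtPrime 𝔪) :=
    IsLocalization.isNoetherianRing 𝔪.primeCompl _ inferInstance
  have : IsNoetherianRing O := isNoetherianRing_of_surjective _ _ ψ.rangeRestrict
    ψ.rangeRestrict_surjective
  have : IsLocalRing O := IsLocalRing.of_surjective' ψ.rangeRestrict ψ.rangeRestrict_surjective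
  have hφO : ∀ g, aeval c g ∈ O := fun g => (hO _).2 ⟨g, 1, by simp, by simp⟩
  let φO : MvPolynomial (Fin 2) k →+* O := φ.codRestrict O hφO
  have hunit : ∀ h : MvPolynomial (Fin 2) k, constantCoeff h ≠ 0 → IsUnit (φO h) := by
    intro h hh
    have hs : aeval c h ≠ 0 := fun e => hh (h0 _ e)
    refine IsUnit.of_mul_eq_one ⟨(aeval c h)⁻¹, (hO _).2 ⟨1, h, hh, by simp⟩⟩ ?_
    ext
    exact mul_inv_cancel₀ hs
  let π : O := φO (X i)
  have hπ : (π : K) = c i := aeval_X c i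
  have hπ0 : π ≠ 0 := fun e => hi (by rw [← hπ, e]; rfl)
  have hcπ : ∀ j, π ∣ φO (X j) := by
    intro j
    obtain ⟨u, w, hu, e⟩ := h1 j
    have e' : φO u * φO (X j) = φO w * π := by
      ext
      have hX : (φO (X j) : K) = c j := aeval_X c j
      have : (φO u : K) * φO (X j) = φO w * π := by rw [hX, hπ]; exact e
      exact this
    obtain ⟨u', hu'⟩ := hunit u hu
    rw [← hu'] at e'
    refine ⟨u'⁻¹ * φO w, ?_⟩
    calc φO (X j) = u'⁻¹ * (u' * φO (X j)) := by simp
      _ = _ := by rw [e']; ring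
  have hspan : (Ideal.span {X 0, X 1} : Ideal (MvPolynomial (Fin 2) k)) ≤
      (Ideal.span {π}).comap φO := by
    rw [Ideal.span_le]
    rintro x (rfl | rfl) <;> exact Ideal.mem_span_singleton.2 (hcπ _)
  -- An inverse g/h of π would make X i * g - h vanish on the curve; `h0` then forces the constant
  -- term of h to be zero.
  have hπu : ¬ IsUnit π := by
    rintro hu
    obtain ⟨w, hw⟩ := hu.exists_right_inv
    obtain ⟨g, h, hh, e⟩ := (hO _).1 w.2
    have hs : aeval c h ≠ 0 := fun e => hh (h0 _ e)
    have : c i * (aeval c g / aeval c h) = 1 := by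
      rw [← e, ← hπ]; exact congrArg Subtype.val hw
    have h3 : aeval c (X i * g - h) = 0 := by
      rw [map_sub, map_mul, aeval_X, sub_eq_zero]
      field_simp at this
      exact this
    have := h0 _ h3
    simp at this
    exact hh this
  have hmax : IsLocalRing.maximalIdeal O = Ideal.span {π} := by
    apply le_antisymm
    · intro z hz
      obtain ⟨g, h, hh, e⟩ := (hO _).1 z.2
      have hs : aeval c h ≠ 0 := fun e => hh (h0 _ e)
      have hz' : φO h * z = φO g := by
        ext
        have : aeval c h * (z : K) = aeval c g := by rw [e]; field_simp
        exact this
      have hg : constantCoeff g = 0 := by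
        by_contra hg
        have := hunit g hg
        rw [← hz'] at this
        exact (IsLocalRing.mem_maximalIdeal z).1 hz (isUnit_of_mul_isUnit_right this)
      have hg' := MvPolynomial.sub_C_constantCoeff_mem g
      rw [hg, map_zero, sub_zero] at hg'
      have := hspan hg'
      rw [Ideal.mem_comap, ← hz'] at this
      rwa [Ideal.unit_mul_mem_iff_mem _ (hunit h hh)] at this
    · rw [Ideal.span_singleton_le_iff_mem, IsLocalRing.mem_maximalIdeal]
      exact hπu
  have hnf : ¬ IsField O := by
    intro hF
    obtain ⟨w, hw⟩ := hF.mul_inv_cancel hπ0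
    exact hπu (IsUnit.of_mul_eq_one _ hw)
  -- Entry 4 of the list of equivalent conditions is principality of the maximal ideal.
  have hdvr : IsDiscreteValuationRing O :=
    ((IsDiscreteValuationRing.TFAE O hnf).out 0 4).2 (by rw [hmax]; exact ⟨π, rfl⟩)
  have hfrac : IsFractionRing O K := by
    refine IsFractionRing.of_field O K fun z => ?_
    have hz : z ∈ IntermediateField.adjoin k (Set.range c) := by rw [h2]; trivial
    rw [IntermediateField.mem_adjoin_range_iff] at hz
    obtain ⟨r, s, e⟩ := hz
    exact ⟨φO r, φO s, e⟩
  let M := IsDiscreteValuationRing.maximalIdeal O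
  have hM : M.asIdeal = Ideal.span {π} := hmax
  refine ⟨M.valuation K, ?_, ?_⟩
  · rw [← hπ]
    have := M.intValuation_singleton hπ0 hM
    rw [← this]
    exact M.valuation_of_algebraMap π
  · intro n f
    constructor
    · intro hf
      have hf1 : M.valuation K f ≤ 1 := hf.trans (by rw [← exp_zero, exp_le_exp]; omega)
      obtain ⟨a, rfl⟩ := IsDiscreteValuationRing.exists_lift_of_le_one hf1
      rw [M.valuation_of_algebraMap, M.intValuation_le_pow_iff_mem, hM,
        Ideal.span_singleton_pow, Ideal.mem_span_singleton] at hf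
      obtain ⟨b, rfl⟩ := hf
      obtain ⟨g, h, hh, e⟩ := (hO _).1 b.2
      refine ⟨X i ^ n * g, h, ?_, hh, ?_⟩
      · apply Ideal.mul_mem_right
        apply Ideal.pow_mem_pow
        apply Ideal.subset_span
        fin_cases i <;> simp
      · rw [map_mul (aeval c), map_pow (aeval c), aeval_X, mul_div_assoc, ← e, ← hπ]
        rfl
    · rintro ⟨g, h, hg, hh, rfl⟩
      have hs : aeval c h ≠ 0 := fun e => hh (h0 _ e)
      obtain ⟨u, hu⟩ := hunit h hh
      have e : aeval c g / aeval c h = algebraMap O K (φO g * (u⁻¹ : Oˣ)) := by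
        rw [div_eq_iff hs]
        have : φO g = φO g * (u⁻¹ : Oˣ) * φO h := by rw [← hu]; simp
        exact congrArg Subtype.val this
      rw [e, M.valuation_of_algebraMap, M.intValuation_le_pow_iff_mem, hM]
      apply Ideal.mul_mem_right
      have := Ideal.pow_right_mono hspan n hg
      exact Ideal.le_comap_pow φO n this

end Chart

/-! ### The coordinate ring and the place at infinity. -/

namespace EllipticFunction

open WeierstrassCurve

noncomputable section

variable {k : Type*} [Field k] (E : WeierstrassCurve k)

/-- The function `x` in the affine coordinate ring. -/
def xCoord : E.toAffine.CoordinateRing :=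
  Affine.CoordinateRing.mk E.toAffine (Polynomial.C Polynomial.X)

/-- The function `y` in the affine coordinate ring. -/
def yCoord : E.toAffine.CoordinateRing := Affine.CoordinateRing.mk E.toAffine Polynomial.X

theorem algebraMap_xCoord : algebraMap _ E.toAffine.FunctionField (xCoord E) = xFun E := rfl

theorem algebraMap_yCoord : algebraMap _ E.toAffine.FunctionField (yCoord E) = yFun E := rfl

theorem algebraMap_coordinateRing (a : k) :
    algebraMap k E.toAffine.CoordinateRing a =
      Affine.CoordinateRing.mk E.toAffine (Polynomial.C (Polynomial.C a)) := rfl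

theorem coord_equation :
    yCoord E ^ 2 + algebraMap k _ E.a₁ * xCoord E * yCoord E + algebraMap k _ E.a₃ * yCoord E =
      xCoord E ^ 3 + algebraMap k _ E.a₂ * xCoord E ^ 2 + algebraMap k _ E.a₄ * xCoord E +
        algebraMap k _ E.a₆ := by
  have h : Affine.CoordinateRing.mk E.toAffine E.toAffine.polynomial = 0 := AdjoinRoot.mk_self
  simp only [Affine.polynomial, map_add, map_sub, map_mul, map_pow] at h
  simp only [algebraMap_coordinateRing, xCoord, yCoord]
  linear_combination h

theorem fun_equation :
    yFun E ^ 2 + algebraMap k _ E.a₁ * xFun E * yFun E + algebraMap k _ E.a₃ * yFun E =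
      xFun E ^ 3 + algebraMap k _ E.a₂ * xFun E ^ 2 + algebraMap k _ E.a₄ * xFun E +
        algebraMap k _ E.a₆ := by
  have := congrArg (algebraMap _ E.toAffine.FunctionField) (coord_equation E)
  simpa only [map_add, map_mul, map_pow, algebraMap_xCoord, algebraMap_yCoord,
    ← IsScalarTower.algebraMap_apply] using this

theorem xFun_sub_ne_zero (a : k) : xFun E - algebraMap k _ a ≠ 0 := by
  have h := Affine.CoordinateRing.XClass_ne_zero (W' := E.toAffine) a
  have h2 := (FaithfulSMul.algebraMap_injective E.toAffine.CoordinateRing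
    E.toAffine.FunctionField).ne h
  rw [map_zero] at h2
  convert h2 using 1
  rw [Affine.CoordinateRing.XClass, ← algebraMap_xCoord, IsScalarTower.algebraMap_apply k
    E.toAffine.CoordinateRing E.toAffine.FunctionField, ← map_sub, algebraMap_coordinateRing,
    xCoord, ← map_sub, ← map_sub]

theorem yFun_sub_ne_zero (b : k) : yFun E - algebraMap k _ b ≠ 0 := by
  have h := Affine.CoordinateRing.YClass_ne_zero (W' := E.toAffine) (Polynomial.C b)
  have h2 := (FaithfulSMul.algebraMap_injective E.toAffine.CoordinateRing
    E.toAffine.FunctionField).ne h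
  rw [map_zero] at h2
  convert h2 using 1
  rw [Affine.CoordinateRing.YClass, ← algebraMap_yCoord, IsScalarTower.algebraMap_apply k
    E.toAffine.CoordinateRing E.toAffine.FunctionField, ← map_sub, algebraMap_coordinateRing,
    yCoord, ← map_sub]

theorem xFun_ne_zero : xFun E ≠ 0 := by simpa using xFun_sub_ne_zero E 0

theorem yFun_ne_zero : yFun E ≠ 0 := by simpa using yFun_sub_ne_zero E 0

theorem exists_polynomial_coord (r : E.toAffine.CoordinateRing) :
    ∃ p q : Polynomial k, r = Polynomial.aeval (xCoord E) p +
      Polynomial.aeval (xCoord E) q * yCoord E := by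
  obtain ⟨p, q, rfl⟩ := Affine.CoordinateRing.exists_smul_basis_eq r
  have key : ∀ p : Polynomial k, Affine.CoordinateRing.mk E.toAffine (Polynomial.C p) =
      Polynomial.aeval (xCoord E) p := by
    intro p
    induction p using Polynomial.induction_on' with
    | add p q hp hq => simp only [map_add, hp, hq]
    | monomial n a =>
      rw [Polynomial.aeval_monomial, ← Polynomial.C_mul_X_pow_eq_monomial, map_mul, map_mul,
        map_pow, map_pow, algebraMap_coordinateRing, xCoord]
  exact ⟨p, q, by rw [Affine.CoordinateRing.smul, Affine.CoordinateRing.smul, key, key, mul_one,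
    yCoord]⟩

variable {E} in
/-- The homomorphism from the coordinate ring given by a solution of the Weierstrass equation. -/
def coordLift {T : Type*} [CommRing T] [Algebra k T] (x y : T)
    (h : y ^ 2 + algebraMap k T E.a₁ * x * y + algebraMap k T E.a₃ * y =
      x ^ 3 + algebraMap k T E.a₂ * x ^ 2 + algebraMap k T E.a₄ * x + algebraMap k T E.a₆) :
    E.toAffine.CoordinateRing →ₐ[k] T :=
  AdjoinRoot.liftAlgHom E.toAffine.polynomial (Polynomial.aeval x) y (by
    rw [Affine.polynomial]
    simp [Polynomial.eval₂_add, Polynomial.eval₂_mul, Polynomial.eval₂_pow]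
    linear_combination h)

variable {E} in
@[simp]
theorem coordLift_xCoord {T : Type*} [CommRing T] [Algebra k T] (x y : T)
    (h : y ^ 2 + algebraMap k T E.a₁ * x * y + algebraMap k T E.a₃ * y =
      x ^ 3 + algebraMap k T E.a₂ * x ^ 2 + algebraMap k T E.a₄ * x + algebraMap k T E.a₆) :
    coordLift x y h (xCoord E) = x := by
  unfold coordLift xCoord Affine.CoordinateRing.mk
  rw [AdjoinRoot.liftAlgHom_mk]
  simp

variable {E} in
@[simp]
theorem coordLift_yCoord {T : Type*} [CommRing T] [Algebra k T] (x y : T)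
    (h : y ^ 2 + algebraMap k T E.a₁ * x * y + algebraMap k T E.a₃ * y =
      x ^ 3 + algebraMap k T E.a₂ * x ^ 2 + algebraMap k T E.a₄ * x + algebraMap k T E.a₆) :
    coordLift x y h (yCoord E) = y := by
  unfold coordLift yCoord Affine.CoordinateRing.mk
  rw [AdjoinRoot.liftAlgHom_mk]
  simp

variable {E} in
/-- Evaluation of a regular function at an affine point. -/
def evalAt {a b : k} (h : E.toAffine.Nonsingular a b) : E.toAffine.CoordinateRing →ₐ[k] k :=
  coordLift a b (by simpa using (Affine.equation_iff _ _).1 h.1)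

@[simp]
theorem evalAt_xCoord {a b : k} (h : E.toAffine.Nonsingular a b) : evalAt h (xCoord E) = a := by
  simp [evalAt]

@[simp]
theorem evalAt_yCoord {a b : k} (h : E.toAffine.Nonsingular a b) : evalAt h (yCoord E) = b := by
  simp [evalAt]

/-- The norm of p + q y has degree max (2 deg p) (2 deg q + 3), which is the pole order at infinity.
This is its ultrametric inequality. -/
theorem degree_norm_add_le (r s : E.toAffine.CoordinateRing) :
    (Algebra.norm (Polynomial k) (r + s)).degree ≤
      max (Algebra.norm (Polynomial k) r).degree (Algebra.norm (Polynomial k) s).degree := by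
  obtain ⟨p, q, rfl⟩ := Affine.CoordinateRing.exists_smul_basis_eq r
  obtain ⟨p', q', rfl⟩ := Affine.CoordinateRing.exists_smul_basis_eq s
  have e : ∀ Y : E.toAffine.CoordinateRing, p • 1 + q • Y + (p' • 1 + q' • Y) =
    (p + p') • 1 + (q + q') • Y := fun Y => by module
  rw [e, Affine.CoordinateRing.degree_norm_smul_basis, Affine.CoordinateRing.degree_norm_smul_basis,
    Affine.CoordinateRing.degree_norm_smul_basis]
  apply max_le
  · rcases le_max_iff.1 (Polynomial.degree_add_le p p') with h | h
    · exact (nsmul_le_nsmul_right h 2).trans (le_max_of_le_left (le_max_left _ _))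
    · exact (nsmul_le_nsmul_right h 2).trans (le_max_of_le_right (le_max_left _ _))
  · rcases le_max_iff.1 (Polynomial.degree_add_le q q') with h | h
    · exact (add_le_add_left (nsmul_le_nsmul_right h 2) 3).trans
        (le_max_of_le_left (le_max_right _ _))
    · exact (add_le_add_left (nsmul_le_nsmul_right h 2) 3).trans
        (le_max_of_le_right (le_max_right _ _))

theorem norm_coord_ne_zero {r : E.toAffine.CoordinateRing} (hr : r ≠ 0) :
    Algebra.norm (Polynomial k) r ≠ 0 := by
  intro h
  obtain ⟨p, q, rfl⟩ := Affine.CoordinateRing.exists_smul_basis_eq r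
  have := Affine.CoordinateRing.degree_norm_smul_basis (W' := E.toAffine) p q
  rw [h, Polynomial.degree_zero, eq_comm, max_eq_bot] at this
  have hp : p = 0 := by
    by_contra hp
    rw [Polynomial.degree_eq_natDegree hp] at this
    exact absurd this.1 (by
      rw [show ((2 : ℕ) • (p.natDegree : WithBot ℕ)) = ((2 * p.natDegree : ℕ) : WithBot ℕ) by simp]
      exact WithBot.natCast_ne_bot _)
  have hq : q = 0 := by
    by_contra hq
    rw [Polynomial.degree_eq_natDegree hq] at this
    exact absurd this.2 (by
      rw [show ((2 : ℕ) • (q.natDegree : WithBot ℕ) + 3) = ((2 * q.natDegree + 3 : ℕ) : WithBot ℕ)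
        by simp]
      exact WithBot.natCast_ne_bot _)
  simp [hp, hq] at hr

open Classical in
/-- The valuation at infinity on the coordinate ring. -/
def coordInftyValuation : Valuation E.toAffine.CoordinateRing ℤᵐ⁰ where
  toFun r := if r = 0 then 0 else exp ((Algebra.norm (Polynomial k) r).natDegree : ℤ)
  map_zero' := by simp
  map_one' := by simp
  map_mul' r s := by
    by_cases hr : r = 0
    · simp [hr]
    by_cases hs : s = 0
    · simp [hs]
    simp only [hr, hs, mul_eq_zero, or_self, if_false, map_mul]
    rw [Polynomial.natDegree_mul (norm_coord_ne_zero E hr) (norm_coord_ne_zero E hs), ← exp_add]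
    push_cast
    rfl
  map_add_le_max' r s := by
    by_cases hr : r = 0
    · simp [hr]
    by_cases hs : s = 0
    · simp [hs]
    by_cases hrs : r + s = 0
    · simp [hrs]
    simp only [hr, hs, hrs, if_false, le_max_iff, exp_le_exp, Nat.cast_le]
    rcases le_max_iff.1 (degree_norm_add_le E r s) with h | h
    · exact Or.inl (Polynomial.natDegree_le_natDegree h)
    · exact Or.inr (Polynomial.natDegree_le_natDegree h)

/-- The norms of x and y have degrees 2 and 3. This valuation serves to verify the hypothesis `h0`
of `exists_valuation_of_chart` at infinity, where no evaluation map is at hand. -/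
theorem exists_infty_valuation : ∃ v : Valuation E.toAffine.FunctionField ℤᵐ⁰,
    v (xFun E) = exp (2 : ℤ) ∧ v (yFun E) = exp (3 : ℤ) ∧ ∀ a : k, v (algebraMap k _ a) ≤ 1 := by
  have hS : nonZeroDivisors E.toAffine.CoordinateRing ≤
      (coordInftyValuation E).supp.primeCompl := by
    intro r hr
    have hr0 := nonZeroDivisors.ne_zero hr
    change r ∉ (coordInftyValuation E).supp
    rw [Valuation.mem_supp_iff]
    simp [coordInftyValuation, hr0]
  have hdeg : ∀ p q : Polynomial k, p ≠ 0 ∨ q ≠ 0 → coordInftyValuation E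
      (p • 1 + q • Affine.CoordinateRing.mk E.toAffine Polynomial.X) = exp
        (((max (2 • p.degree) (2 • q.degree + 3)).unbotD 0 : ℕ) : ℤ) := by
    intro p q hpq
    have hne : p • 1 + q • Affine.CoordinateRing.mk E.toAffine Polynomial.X ≠ 0 := by
      intro h
      have := Affine.CoordinateRing.smul_basis_eq_zero h
      tauto
    change (if _ then _ else _) = _
    rw [if_neg hne, Polynomial.natDegree, Affine.CoordinateRing.degree_norm_smul_basis]
  refine ⟨(coordInftyValuation E).extendToLocalization hS _, ?_, ?_, ?_⟩
  · rw [← algebraMap_xCoord, Valuation.extendToLocalization_apply_map_apply]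
    have := hdeg Polynomial.X 0 (Or.inl Polynomial.X_ne_zero)
    rw [Affine.CoordinateRing.smul, zero_smul, add_zero, mul_one] at this
    rw [xCoord, this]
    simp
  · rw [← algebraMap_yCoord, Valuation.extendToLocalization_apply_map_apply]
    have := hdeg 0 1 (Or.inr one_ne_zero)
    rw [one_smul, zero_smul, zero_add] at this
    rw [yCoord, this]
    simp
  · intro a
    rw [IsScalarTower.algebraMap_apply k E.toAffine.CoordinateRing,
      Valuation.extendToLocalization_apply_map_apply]
    by_cases ha : a = 0
    · simp [ha]
    have := hdeg (Polynomial.C a) 0 (Or.inl (by simpa using ha))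
    rw [Affine.CoordinateRing.smul, zero_smul, add_zero, mul_one] at this
    rw [algebraMap_coordinateRing, this]
    simp [Polynomial.degree_C ha]

end

end EllipticFunction

/-! ### Valuations of polynomials in local coordinates. -/

section

open MvPolynomial

variable {k K : Type*} [Field k] [Field K] [Algebra k K] {v : Valuation K ℤᵐ⁰}

theorem Valuation.aeval_le (hk : ∀ a : k, v (algebraMap k K a) ≤ 1) {c : Fin 2 → K}
    (hc : ∀ j, v (c j) ≤ exp (-1 : ℤ)) {n : ℕ} {p : MvPolynomial (Fin 2) k}
    (hp : p ∈ (Ideal.span {X 0, X 1} : Ideal (MvPolynomial (Fin 2) k)) ^ n) :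
    v (aeval c p) ≤ exp (-(n : ℤ)) := by
  have hc1 : ∀ j, v (c j) ≤ 1 := fun j => (hc j).trans (by rw [← exp_zero, exp_le_exp]; omega)
  have h1 : ∀ p : MvPolynomial (Fin 2) k, v (aeval c p) ≤ 1 := by
    intro p
    induction p using MvPolynomial.induction_on with
    | C a => simpa using hk a
    | add p q hp hq => rw [map_add]; exact v.map_add_le hp hq
    | mul_X p i hp =>
      rw [map_mul, map_mul, aeval_X]
      exact mul_le_one' hp (hc1 i)
  induction n generalizing p with
  | zero => simpa using h1 p
  | succ n ih =>
    rw [pow_succ] at hp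
    induction hp using Submodule.mul_induction_on' with
    | mem_mul_mem a ha b hb =>
      obtain ⟨s, t, rfl⟩ := Ideal.mem_span_pair.1 hb
      have hb' : v (aeval c (s * X 0 + t * X 1)) ≤ exp (-1 : ℤ) := by
        rw [map_add, map_mul, map_mul, aeval_X, aeval_X]
        apply v.map_add_le <;> rw [map_mul]
        · exact (mul_le_mul' (h1 s) (hc 0)).trans (by rw [one_mul])
        · exact (mul_le_mul' (h1 t) (hc 1)).trans (by rw [one_mul])
      rw [map_mul, map_mul]
      refine (mul_le_mul' (ih ha) hb').trans ?_
      rw [← exp_add, exp_le_exp]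
      push_cast
      omega
    | add a _ b _ ha hb => rw [map_add]; exact v.map_add_le ha hb

theorem Valuation.algebraMap_eq_one (hk : ∀ a : k, v (algebraMap k K a) ≤ 1) {a : k}
    (ha : a ≠ 0) : v (algebraMap k K a) = 1 := by
  refine le_antisymm (hk a) ?_
  have h1 : v (algebraMap k K a) * v (algebraMap k K a⁻¹) = 1 := by
    rw [← map_mul, ← map_mul, mul_inv_cancel₀ ha, map_one, map_one]
  calc (1 : ℤᵐ⁰) = v (algebraMap k K a) * v (algebraMap k K a⁻¹) := h1.symm
    _ ≤ v (algebraMap k K a) * 1 := mul_le_mul_right (hk _) _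
    _ = _ := mul_one _

theorem Valuation.aeval_eq_one (hk : ∀ a : k, v (algebraMap k K a) ≤ 1) {c : Fin 2 → K}
    (hc : ∀ j, v (c j) ≤ exp (-1 : ℤ)) {p : MvPolynomial (Fin 2) k}
    (hp : constantCoeff p ≠ 0) : v (aeval c p) = 1 := by
  have h1 : v (aeval c (p - C (constantCoeff p))) ≤ exp (-1 : ℤ) := by
    have := Valuation.aeval_le (v := v) hk hc (n := 1) (p := p - C (constantCoeff p))
      (by rw [pow_one]; exact sub_C_constantCoeff_mem p)
    simpa using this
  have h2 := Valuation.algebraMap_eq_one hk hp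
  have e : aeval c p = algebraMap k K (constantCoeff p) + aeval c (p - C (constantCoeff p)) := by
    rw [_root_.map_sub, aeval_C]; ring
  rw [e, Valuation.map_add_eq_of_lt_left, h2]
  rw [h2]
  exact h1.trans_lt (by rw [← exp_zero, exp_lt_exp]; omega)

end

/-! ### The valuation attached to a point of the curve. -/

namespace EllipticFunction

open WeierstrassCurve

noncomputable section

variable {k : Type*} [Field k] {E : WeierstrassCurve k}

variable (E) in
theorem adjoin_xFun_yFun {L : IntermediateField k E.toAffine.FunctionField}
    (hx : xFun E ∈ L) (hy : yFun E ∈ L) : L = ⊤ := by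
  have hR : ∀ r : E.toAffine.CoordinateRing, algebraMap _ E.toAffine.FunctionField r ∈ L := by
    intro r
    obtain ⟨p, q, rfl⟩ := exists_polynomial_coord E r
    have hp : ∀ p : Polynomial k, algebraMap _ E.toAffine.FunctionField
        (Polynomial.aeval (xCoord E) p) ∈ L := by
      intro p
      rw [← Polynomial.aeval_algebraMap_apply, algebraMap_xCoord]
      exact Algebra.adjoin_le (S := L.toSubalgebra) (Set.singleton_subset_iff.2 hx)
        (Polynomial.aeval_mem_adjoin_singleton k (xFun E))
    rw [map_add, map_mul]
    exact add_mem (hp p) (mul_mem (hp q) hy)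
  rw [eq_top_iff]
  intro f _
  obtain ⟨a, b, _, rfl⟩ := IsFractionRing.div_surjective E.toAffine.CoordinateRing f
  exact div_mem (hR a) (hR b)

theorem algebraMap_eq_aeval_chart {a b : k} (h : E.toAffine.Nonsingular a b)
    (r : E.toAffine.CoordinateRing) : ∃ g : MvPolynomial (Fin 2) k,
      algebraMap _ _ r = MvPolynomial.aeval (chart E (.some a b h)) g ∧
      MvPolynomial.constantCoeff g = evalAt h r := by
  obtain ⟨p, q, rfl⟩ := exists_polynomial_coord E r
  let x' : MvPolynomial (Fin 2) k := MvPolynomial.X 0 + MvPolynomial.C a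
  let y' : MvPolynomial (Fin 2) k := MvPolynomial.X 1 + MvPolynomial.C b
  have hx : MvPolynomial.aeval (chart E (.some a b h)) x' = xFun E := by
    simp [x', chart]
  have hy : MvPolynomial.aeval (chart E (.some a b h)) y' = yFun E := by
    simp [y', chart]
  refine ⟨Polynomial.aeval x' p + Polynomial.aeval x' q * y', ?_, ?_⟩
  · simp only [map_add, map_mul, ← Polynomial.aeval_algHom_apply, hx, hy,
      ← Polynomial.aeval_algebraMap_apply, algebraMap_xCoord, algebraMap_yCoord]
  · have hc : ∀ p : Polynomial k, MvPolynomial.constantCoeff (Polynomial.aeval x' p) =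
        Polynomial.aeval a p := by
      intro p
      have := Polynomial.map_aeval_eq_aeval_map (S := MvPolynomial (Fin 2) k) (T := k)
        (φ := RingHom.id k) (ψ := MvPolynomial.constantCoeff) (by ext; simp) p x'
      simpa [x'] using this
    simp only [map_add, map_mul, ← Polynomial.aeval_algHom_apply, hc, evalAt_xCoord, evalAt_yCoord]
    simp [y']

/-- The coordinate functions around an affine point, as regular functions. -/
def coordChart {a b : k} (_ : E.toAffine.Nonsingular a b) : Fin 2 → E.toAffine.CoordinateRing :=
  ![xCoord E - algebraMap k _ a, yCoord E - algebraMap k _ b]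

theorem algebraMap_coordChart {a b : k} (h : E.toAffine.Nonsingular a b) (i : Fin 2) :
    algebraMap _ _ (coordChart h i) = chart E (.some a b h) i := by
  fin_cases i
  · simp [chart, coordChart, algebraMap_xCoord, ← IsScalarTower.algebraMap_apply]
  · simp [chart, coordChart, algebraMap_yCoord, ← IsScalarTower.algebraMap_apply]

theorem algebraMap_aeval_coordChart {a b : k} (h : E.toAffine.Nonsingular a b)
    (g : MvPolynomial (Fin 2) k) : algebraMap _ _ (MvPolynomial.aeval (coordChart h) g) =
      MvPolynomial.aeval (chart E (.some a b h)) g := by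
  rw [← funext (algebraMap_coordChart h), ← MvPolynomial.aeval_algebraMap_apply]
  rfl

theorem evalAt_aeval_coordChart {a b : k} (h : E.toAffine.Nonsingular a b)
    (g : MvPolynomial (Fin 2) k) :
    evalAt h (MvPolynomial.aeval (coordChart h) g) = MvPolynomial.constantCoeff g := by
  have : (evalAt h).comp (MvPolynomial.aeval (coordChart h)) = MvPolynomial.aeval 0 := by
    ext i
    fin_cases i <;> simp [coordChart]
  rw [← AlgHom.comp_apply, this]
  simp [MvPolynomial.aeval_zero]

/-- At an affine point the constant term is the value of a regular function. At infinity a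
polynomial with non-zero constant term has valuation 1, hence is non-zero. -/
theorem constantCoeff_eq_zero_of_aeval_chart {P : E.toAffine.Point} {g : MvPolynomial (Fin 2) k}
    (hg : MvPolynomial.aeval (chart E P) g = 0) : MvPolynomial.constantCoeff g = 0 := by
  cases P with
  | zero =>
    obtain ⟨v, hx, hy, hk⟩ := exists_infty_valuation E
    by_contra hne
    have := Valuation.aeval_eq_one (v := v) (c := chart E .zero) hk (fun j => by
      fin_cases j
      · simp [chart, hx, hy, ← exp_sub]
      · simp [chart, hy, ← exp_neg]) hne
    rw [hg, map_zero] at this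
    exact zero_ne_one this
  | some a b h =>
    rw [← algebraMap_aeval_coordChart, FaithfulSMul.algebraMap_eq_zero_iff] at hg
    rw [← evalAt_aeval_coordChart h, hg, map_zero]

theorem chart_ne_zero (P : E.toAffine.Point) (i : Fin 2) : chart E P i ≠ 0 := by
  cases P with
  | zero =>
    fin_cases i
    · simp [chart, xFun_ne_zero, yFun_ne_zero]
    · simp [chart, yFun_ne_zero]
  | some a b h =>
    fin_cases i
    · exact xFun_sub_ne_zero E a
    · exact yFun_sub_ne_zero E b

theorem adjoin_chart (P : E.toAffine.Point) :
    IntermediateField.adjoin k (Set.range (chart E P)) = ⊤ := by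
  have hm : ∀ i, chart E P i ∈ IntermediateField.adjoin k (Set.range (chart E P)) := fun i =>
    IntermediateField.subset_adjoin _ _ ⟨i, rfl⟩
  cases P with
  | zero =>
    have hy : yFun E ∈ IntermediateField.adjoin k (Set.range (chart E .zero)) := by
      have := inv_mem (hm 1)
      simpa [chart] using this
    refine adjoin_xFun_yFun E ?_ hy
    have := mul_mem (hm 0) hy
    simpa [chart, yFun_ne_zero] using this
  | some a b h =>
    apply adjoin_xFun_yFun E
    · have := add_mem (hm 0) (algebraMap_mem _ a)
      simpa [chart] using this
    · have := add_mem (hm 1) (algebraMap_mem _ b)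
      simpa [chart] using this

/-- Subtract the Weierstrass equation at (a, b) from the one at (x, y), splitting a₁(xy - ab) as
a₁a(y - b) + a₁(x - a)y. This relation between the two local coordinates gives both a uniformizer
and the divisor of x - a. -/
theorem line_mul_line {a b : k} (h : E.toAffine.Equation a b) :
    (yFun E - algebraMap k _ b) * (yFun E - algebraMap k _ (E.toAffine.negY a b)) =
      (xFun E - algebraMap k _ a) * (xFun E ^ 2 + algebraMap k _ a * xFun E + algebraMap k _ a ^ 2
        + algebraMap k _ E.a₂ * (xFun E + algebraMap k _ a) + algebraMap k _ E.a₄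
        - algebraMap k _ E.a₁ * yFun E) := by
  have h1 := congrArg (algebraMap k E.toAffine.FunctionField) ((Affine.equation_iff _ _).1 h)
  have h2 := fun_equation E
  simp only [map_add, map_mul, map_pow] at h1
  simp only [Affine.negY, map_sub, map_mul, map_neg]
  linear_combination h2 - h1

/-- One coordinate generates the maximal ideal. At infinity 1/y is (x/y)³ up to a unit, so x/y
works. At an affine point `line_mul_line` is used: off the 2-torsion the factor y - `negY` is a unit
and x - a works; at a 2-torsion point nonsingularity makes the quadratic factor a unit, and y - b
works. -/
theorem chart_principal (P : E.toAffine.Point) : ∃ i, ∀ j, ∃ u v : MvPolynomial (Fin 2) k,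
    MvPolynomial.constantCoeff u ≠ 0 ∧ MvPolynomial.aeval (chart E P) u * chart E P j =
      MvPolynomial.aeval (chart E P) v * chart E P i := by
  open MvPolynomial in
  cases P with
  | zero =>
    refine ⟨0, fun j => ?_⟩
    fin_cases j
    · exact ⟨1, 1, by simp, rfl⟩
    · refine ⟨1 + C E.a₁ * X 0 + C E.a₃ * X 1 - C E.a₂ * X 0 ^ 2 - C E.a₄ * X 0 * X 1 -
        C E.a₆ * X 1 ^ 2, X 0 ^ 2, by simp, ?_⟩
      have h2 := fun_equation E
      have hy := yFun_ne_zero E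
      simp [chart]
      field_simp
      linear_combination h2
  | some a b h =>
    have hl := line_mul_line h.1
    have hns := (Affine.nonsingular_iff a b).1 h
    rw [← Affine.negY] at hns
    generalize E.toAffine.negY a b = b' at hl hns
    by_cases hb : b = b'
    · refine ⟨1, fun j => ?_⟩
      fin_cases j
      · refine ⟨(X 0 + C a) ^ 2 + C a * (X 0 + C a) + C a ^ 2 + C E.a₂ * ((X 0 + C a) + C a)
          + C E.a₄ - C E.a₁ * (X 1 + C b), X 1, ?_, ?_⟩
        · rcases hns.2 with h' | h'
          · simp only [map_add, map_sub, map_mul, map_pow, constantCoeff_X, constantCoeff_C]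
            intro e
            apply h'
            linear_combination -e
          · exact absurd hb h'
        · simp [chart]
          rw [← hb] at hl
          linear_combination -hl
      · exact ⟨1, 1, by simp, rfl⟩
    · refine ⟨0, fun j => ?_⟩
      fin_cases j
      · exact ⟨1, 1, by simp, rfl⟩
      · refine ⟨X 1 + C b - C b', (X 0 + C a) ^ 2 + C a * (X 0 + C a) + C a ^ 2
          + C E.a₂ * ((X 0 + C a) + C a) + C E.a₄ - C E.a₁ * (X 1 + C b), ?_, ?_⟩
        · simpa [sub_eq_zero] using hb
        · simp [chart]
          linear_combination hl

theorem exists_pointValuation (P : E.toAffine.Point) :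
    ∃ v : Valuation E.toAffine.FunctionField ℤᵐ⁰, (∃ i, v (chart E P i) = exp (-1 : ℤ)) ∧
      ∀ (n : ℕ) f, v f ≤ exp (-(n : ℤ)) ↔ f ∈ maxIdealPow P n := by
  obtain ⟨i, hi⟩ := chart_principal P
  obtain ⟨v, hv, h⟩ := exists_valuation_of_chart (chart E P)
    (fun g hg => constantCoeff_eq_zero_of_aeval_chart hg) i (chart_ne_zero P i) hi (adjoin_chart P)
  exact ⟨v, ⟨i, hv⟩, h⟩

/-- The valuation of the function field at a point. -/
def pointValuation (P : E.toAffine.Point) : Valuation E.toAffine.FunctionField ℤᵐ⁰ :=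
  (exists_pointValuation P).choose

theorem exists_pointValuation_chart (P : E.toAffine.Point) :
    ∃ i, pointValuation P (chart E P i) = exp (-1 : ℤ) :=
  (exists_pointValuation P).choose_spec.1

theorem pointValuation_le_iff (P : E.toAffine.Point) (n : ℕ) (f : E.toAffine.FunctionField) :
    pointValuation P f ≤ exp (-(n : ℤ)) ↔ f ∈ maxIdealPow P n :=
  (exists_pointValuation P).choose_spec.2 n f

theorem pointValuation_algebraMap_le (P : E.toAffine.Point) (a : k) :
    pointValuation P (algebraMap k _ a) ≤ 1 := by
  have := (pointValuation_le_iff P 0 (algebraMap k _ a)).2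
    ⟨MvPolynomial.C a, 1, by simp, by simp, by simp⟩
  simpa using this

theorem pointValuation_chart_le (P : E.toAffine.Point) (i : Fin 2) :
    pointValuation P (chart E P i) ≤ exp (-1 : ℤ) := by
  have := (pointValuation_le_iff P 1 (chart E P i)).2
    ⟨MvPolynomial.X i, 1, by
      rw [pow_one]; apply Ideal.subset_span; fin_cases i <;> simp, by simp, by simp⟩
  simpa using this

theorem pointValuation_algebraMap (P : E.toAffine.Point) {a : k} (ha : a ≠ 0) :
    pointValuation P (algebraMap k _ a) = 1 :=
  Valuation.algebraMap_eq_one (pointValuation_algebraMap_le P) ha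

end

/-! ### Orders of vanishing. -/

noncomputable section

variable {k : Type*} [Field k] {E : WeierstrassCurve k}

/-- The order of vanishing of a rational function at a point, with the junk value `0` at `0`. -/
def ord (P : E.toAffine.Point) (f : E.toAffine.FunctionField) : ℤ :=
  -log (pointValuation P f)

theorem pointValuation_eq_exp (P : E.toAffine.Point) {f : E.toAffine.FunctionField} (hf : f ≠ 0) :
    pointValuation P f = exp (-ord P f) := by
  rw [ord, neg_neg, exp_log ((Valuation.ne_zero_iff _).2 hf)]

theorem ord_eq_of_pointValuation {P : E.toAffine.Point} {f : E.toAffine.FunctionField} {n : ℤ}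
    (h : pointValuation P f = exp (-n)) : ord P f = n := by
  rw [ord, h, log_exp, neg_neg]

theorem le_ord_iff (P : E.toAffine.Point) {f : E.toAffine.FunctionField} (hf : f ≠ 0) (n : ℤ) :
    n ≤ ord P f ↔ pointValuation P f ≤ exp (-n) := by
  rw [pointValuation_eq_exp P hf, exp_le_exp, neg_le_neg_iff]

@[simp]
theorem ord_zero (P : E.toAffine.Point) : ord P 0 = 0 := by simp [ord]

@[simp]
theorem ord_one (P : E.toAffine.Point) : ord P 1 = 0 := by simp [ord]

theorem ord_mul (P : E.toAffine.Point) {f g : E.toAffine.FunctionField} (hf : f ≠ 0) (hg : g ≠ 0) :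
    ord P (f * g) = ord P f + ord P g := by
  rw [ord, map_mul, log_mul ((Valuation.ne_zero_iff _).2 hf) ((Valuation.ne_zero_iff _).2 hg),
    ord, ord]
  ring

@[simp]
theorem ord_inv (P : E.toAffine.Point) (f : E.toAffine.FunctionField) :
    ord P f⁻¹ = -ord P f := by
  rw [ord, map_inv₀, log_inv, ord]

theorem ord_div (P : E.toAffine.Point) {f g : E.toAffine.FunctionField} (hf : f ≠ 0) (hg : g ≠ 0) :
    ord P (f / g) = ord P f - ord P g := by
  rw [div_eq_mul_inv, ord_mul P hf (inv_ne_zero hg), ord_inv, sub_eq_add_neg]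

@[simp]
theorem ord_pow (P : E.toAffine.Point) (f : E.toAffine.FunctionField) (n : ℕ) :
    ord P (f ^ n) = n * ord P f := by
  rw [ord, map_pow, log_pow, ord, nsmul_eq_mul, mul_neg]

@[simp]
theorem ord_neg (P : E.toAffine.Point) (f : E.toAffine.FunctionField) :
    ord P (-f) = ord P f := by
  rw [ord, Valuation.map_neg, ord]

theorem ord_sub_comm (P : E.toAffine.Point) (f g : E.toAffine.FunctionField) :
    ord P (f - g) = ord P (g - f) := by
  rw [← neg_sub, ord_neg]

@[simp]
theorem ord_algebraMap (P : E.toAffine.Point) (a : k) : ord P (algebraMap k _ a) = 0 := by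
  by_cases ha : a = 0
  · simp [ha]
  · rw [ord, pointValuation_algebraMap P ha, log_one, neg_zero]

/-- The alternatives f = 0 and g = 0 stand for infinite order, since `ord P 0` has the default value
0. -/
theorem le_ord_add {P : E.toAffine.Point} {f g : E.toAffine.FunctionField} {n : ℤ}
    (h : f + g ≠ 0) (hf : f = 0 ∨ n ≤ ord P f) (hg : g = 0 ∨ n ≤ ord P g) :
    n ≤ ord P (f + g) := by
  rw [le_ord_iff P h]
  apply Valuation.map_add_le
  · rcases eq_or_ne f 0 with rfl | h0
    · simp
    · exact (le_ord_iff P h0 n).1 (hf.resolve_left h0)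
  · rcases eq_or_ne g 0 with rfl | h0
    · simp
    · exact (le_ord_iff P h0 n).1 (hg.resolve_left h0)

theorem ord_add_eq {P : E.toAffine.Point} {f g : E.toAffine.FunctionField} (hf : f ≠ 0)
    (h : g = 0 ∨ ord P f < ord P g) : ord P (f + g) = ord P f := by
  rcases eq_or_ne g 0 with rfl | h0
  · simp
  · have h := h.resolve_left h0
    rw [ord, Valuation.map_add_eq_of_lt_left, ord]
    rwa [pointValuation_eq_exp P hf, pointValuation_eq_exp P h0, exp_lt_exp, neg_lt_neg_iff]

/-- At a pole the set of admissible exponents is empty; its supremum 0 agrees with `toNat` of a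
negative order. -/
theorem zeroMult_eq {f : E.toAffine.FunctionField} (hf : f ≠ 0) (P : E.toAffine.Point) :
    zeroMult f P = (ord P f).toNat := by
  have h : {n : ℕ | f ∈ maxIdealPow P n} = {n : ℕ | (n : ℤ) ≤ ord P f} := by
    ext n
    rw [Set.mem_ofPred_eq, Set.mem_ofPred_eq, ← pointValuation_le_iff, le_ord_iff P hf]
  rw [zeroMult, h]
  by_cases hn : 0 ≤ ord P f
  · have : {n : ℕ | (n : ℤ) ≤ ord P f} = Set.Iic (ord P f).toNat := by
      ext n
      rw [Set.mem_ofPred_eq, Set.mem_Iic]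
      omega
    rw [this, csSup_Iic]
  · have : {n : ℕ | (n : ℤ) ≤ ord P f} = ∅ :=
      Set.eq_empty_of_forall_notMem fun n hn' => hn ((Int.natCast_nonneg n).trans hn')
    rw [this, csSup_empty, Int.toNat_of_nonpos (by omega)]
    rfl

/-- The residue field is k: the value of g/h at the point is the quotient of the constant terms. -/
theorem exists_ord_sub_pos {P : E.toAffine.Point} {f : E.toAffine.FunctionField}
    (hf : 0 ≤ ord P f) : ∃ c : k, f = algebraMap k _ c ∨ 0 < ord P (f - algebraMap k _ c) := by
  rcases eq_or_ne f 0 with rfl | h0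
  · exact ⟨0, by simp⟩
  have h1 : pointValuation P f ≤ exp (-((0 : ℕ) : ℤ)) := by
    simpa using (le_ord_iff P h0 0).1 hf
  obtain ⟨g, h, -, hh, e⟩ := (pointValuation_le_iff P 0 f).1 h1
  have hhne : MvPolynomial.aeval (chart E P) h ≠ 0 := fun e' =>
    hh (constantCoeff_eq_zero_of_aeval_chart e')
  refine ⟨MvPolynomial.constantCoeff g / MvPolynomial.constantCoeff h, ?_⟩
  rw [or_iff_not_imp_left, ← sub_eq_zero]
  intro hne
  have hp : g * MvPolynomial.C (MvPolynomial.constantCoeff h) -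
      h * MvPolynomial.C (MvPolynomial.constantCoeff g) ∈
      (Ideal.span {MvPolynomial.X 0, MvPolynomial.X 1} : Ideal (MvPolynomial (Fin 2) k)) := by
    have := MvPolynomial.sub_C_constantCoeff_mem
      (g * MvPolynomial.C (MvPolynomial.constantCoeff h) -
      h * MvPolynomial.C (MvPolynomial.constantCoeff g))
    simpa [mul_comm] using this
  have h2 := (pointValuation_le_iff P 1 (f - algebraMap k _
      (MvPolynomial.constantCoeff g / MvPolynomial.constantCoeff h))).2
    ⟨_, h * MvPolynomial.C (MvPolynomial.constantCoeff h), by rw [pow_one]; exact hp,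
      by simpa using hh, by
        have hh' : algebraMap k E.toAffine.FunctionField (MvPolynomial.constantCoeff h) ≠ 0 := by
          simpa using hh
        simp only [map_sub, map_mul, MvPolynomial.aeval_C, map_div₀, e]
        field_simp⟩
  have := (le_ord_iff P hne 1).2 (by simpa using h2)
  omega

theorem pointValuation_coord_le {a b : k} (h : E.toAffine.Nonsingular a b)
    (r : E.toAffine.CoordinateRing) : pointValuation (.some a b h) (algebraMap _ _ r) ≤ 1 := by
  obtain ⟨g, hg, -⟩ := algebraMap_eq_aeval_chart h r
  rw [hg]
  have := Valuation.aeval_le (v := pointValuation (.some a b h)) (pointValuation_algebraMap_le _)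
    (pointValuation_chart_le _) (n := 0) (p := g) (by simp)
  simpa using this

theorem ord_coord_nonneg {a b : k} (h : E.toAffine.Nonsingular a b)
    (r : E.toAffine.CoordinateRing) :
    0 ≤ ord (.some a b h) (algebraMap _ E.toAffine.FunctionField r) := by
  rcases eq_or_ne r 0 with rfl | h0
  · simp
  rw [le_ord_iff _ (by simpa using h0)]
  simpa using pointValuation_coord_le h r

theorem ord_coord_eq_zero {a b : k} (h : E.toAffine.Nonsingular a b)
    {r : E.toAffine.CoordinateRing} (hr : evalAt h r ≠ 0) :
    ord (.some a b h) (algebraMap _ E.toAffine.FunctionField r) = 0 := by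
  obtain ⟨g, hg, hc⟩ := algebraMap_eq_aeval_chart h r
  rw [ord, hg, Valuation.aeval_eq_one (pointValuation_algebraMap_le _)
    (pointValuation_chart_le _) (by rwa [hc]), log_one, neg_zero]

theorem ord_coord_pos {a b : k} (h : E.toAffine.Nonsingular a b)
    {r : E.toAffine.CoordinateRing} (hr0 : r ≠ 0) (hr : evalAt h r = 0) :
    0 < ord (.some a b h) (algebraMap _ E.toAffine.FunctionField r) := by
  obtain ⟨g, hg, hc⟩ := algebraMap_eq_aeval_chart h r
  have hg1 := MvPolynomial.sub_C_constantCoeff_mem g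
  rw [hc, hr, map_zero, sub_zero, ← pow_one (Ideal.span _)] at hg1
  have := Valuation.aeval_le (v := pointValuation (.some a b h)) (pointValuation_algebraMap_le _)
    (pointValuation_chart_le _) hg1
  rw [← hg] at this
  have := (le_ord_iff (.some a b h) (by simpa using hr0) 1).2 this
  omega

end

noncomputable section

variable {k : Type*} [Field k] {E : WeierstrassCurve k}

/-! ### The involution -/

variable (E) in
/-- The automorphism of the coordinate ring induced by `P ↦ -P`. -/
def coordNeg : E.toAffine.CoordinateRing →ₐ[k] E.toAffine.CoordinateRing :=
  coordLift (xCoord E) (-yCoord E - algebraMap k _ E.a₁ * xCoord E - algebraMap k _ E.a₃)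
    (by linear_combination coord_equation E)

variable (E) in
theorem coordNeg_apply (p q : Polynomial k) :
    coordNeg E (Polynomial.aeval (xCoord E) p + Polynomial.aeval (xCoord E) q * yCoord E) =
      Polynomial.aeval (xCoord E) p + Polynomial.aeval (xCoord E) q *
        (-yCoord E - algebraMap k _ E.a₁ * xCoord E - algebraMap k _ E.a₃) := by
  simp only [map_add, map_mul, ← Polynomial.aeval_algHom_apply]
  simp [coordNeg]

theorem coordNeg_coordNeg (r : E.toAffine.CoordinateRing) : coordNeg E (coordNeg E r) = r := by
  obtain ⟨p, q, rfl⟩ := exists_polynomial_coord E r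
  rw [coordNeg_apply]
  have h : coordNeg E (yCoord E) =
      -yCoord E - algebraMap k _ E.a₁ * xCoord E - algebraMap k _ E.a₃ := by
    simp [coordNeg]
  have h' : coordNeg E (xCoord E) = xCoord E := by simp [coordNeg]
  simp only [map_add, map_sub, map_neg, map_mul, ← Polynomial.aeval_algHom_apply, h, h',
    AlgHom.commutes]
  ring

/-- The norm to `k(x)` of a regular function is a polynomial in `x`. -/
theorem exists_mul_coordNeg (r : E.toAffine.CoordinateRing) : ∃ p : Polynomial k,
    r * coordNeg E r = Polynomial.aeval (xCoord E) p := by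
  obtain ⟨p, q, rfl⟩ := exists_polynomial_coord E r
  refine ⟨p ^ 2 - p * q * (Polynomial.C E.a₁ * Polynomial.X + Polynomial.C E.a₃) -
    q ^ 2 * (Polynomial.X ^ 3 + Polynomial.C E.a₂ * Polynomial.X ^ 2 +
      Polynomial.C E.a₄ * Polynomial.X + Polynomial.C E.a₆), ?_⟩
  rw [coordNeg_apply]
  simp only [map_add, map_sub, map_mul, map_pow, Polynomial.aeval_C, Polynomial.aeval_X]
  linear_combination -(Polynomial.aeval (xCoord E) q) ^ 2 * coord_equation E

theorem coordNeg_injective : Function.Injective (coordNeg E) :=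
  Function.LeftInverse.injective coordNeg_coordNeg

variable (E) in
theorem algHom_comp_coordNeg_injective : Function.Injective
    ((Algebra.algHom k E.toAffine.CoordinateRing E.toAffine.FunctionField).comp (coordNeg E)) := by
  intro r s h
  exact coordNeg_injective (FaithfulSMul.algebraMap_injective E.toAffine.CoordinateRing
    E.toAffine.FunctionField h)

variable (E) in
/-- The automorphism of the function field induced by `P ↦ -P`. -/
def funNeg : E.toAffine.FunctionField →ₐ[k] E.toAffine.FunctionField :=
  IsFractionRing.liftAlgHom (algHom_comp_coordNeg_injective E)

theorem funNeg_algebraMap (r : E.toAffine.CoordinateRing) :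
    funNeg E (algebraMap _ _ r) = algebraMap _ _ (coordNeg E r) :=
  IsFractionRing.lift_algebraMap (algHom_comp_coordNeg_injective E) r

theorem funNeg_funNeg (f : E.toAffine.FunctionField) : funNeg E (funNeg E f) = f := by
  obtain ⟨a, b, _, rfl⟩ := IsFractionRing.div_surjective E.toAffine.CoordinateRing f
  simp only [map_div₀, funNeg_algebraMap, coordNeg_coordNeg]

theorem funNeg_xFun : funNeg E (xFun E) = xFun E := by
  rw [← algebraMap_xCoord, funNeg_algebraMap]
  simp [coordNeg]

theorem funNeg_yFun : funNeg E (yFun E) =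
    -yFun E - algebraMap k _ E.a₁ * xFun E - algebraMap k _ E.a₃ := by
  rw [← algebraMap_yCoord, funNeg_algebraMap]
  simp [coordNeg, algebraMap_xCoord, algebraMap_yCoord, ← IsScalarTower.algebraMap_apply]

/-- Negation is regular at every point. At infinity it multiplies y by the unit -1 - a₁(x/y) -
a₃(1/y). -/
theorem pointValuation_funNeg_chart_le (P : E.toAffine.Point) (i : Fin 2) :
    pointValuation P (funNeg E (chart E (-P) i)) ≤ exp (-1 : ℤ) := by
  cases P with
  | zero =>
    change pointValuation .zero (funNeg E (chart E .zero i)) ≤ exp (-1 : ℤ)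
    let p : MvPolynomial (Fin 2) k := - 1 - MvPolynomial.C E.a₁ * MvPolynomial.X 0 -
      MvPolynomial.C E.a₃ * MvPolynomial.X 1
    have hp : pointValuation .zero (MvPolynomial.aeval (chart E .zero) p) = 1 :=
      Valuation.aeval_eq_one (pointValuation_algebraMap_le _) (pointValuation_chart_le _)
        (by simp [p])
    have hy := yFun_ne_zero E
    have hyp : funNeg E (yFun E) = yFun E * MvPolynomial.aeval (chart E .zero) p := by
      rw [funNeg_yFun]
      simp [p, chart]
      field_simp
    have hi : funNeg E (chart E .zero i) =
        chart E .zero i / MvPolynomial.aeval (chart E .zero) p := by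
      fin_cases i
      · change funNeg E (xFun E / yFun E) = xFun E / yFun E / _
        rw [map_div₀, funNeg_xFun, hyp, div_div]
      · change funNeg E (1 / yFun E) = 1 / yFun E / _
        rw [map_div₀, map_one, hyp, div_div]
    rw [hi, map_div₀, hp, div_one]
    exact pointValuation_chart_le _ _
  | some a b h =>
    fin_cases i
    · have := pointValuation_chart_le (.some a b h) 0
      simpa [chart, Affine.Point.neg_some, funNeg_xFun] using this
    · have h0 := pointValuation_chart_le (.some a b h) 0
      have h1 := pointValuation_chart_le (.some a b h) 1
      have e : funNeg E (chart E (-(.some a b h)) 1) = -(chart E (.some a b h) 1) -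
          algebraMap k _ E.a₁ * chart E (.some a b h) 0 := by
        simp [chart, Affine.Point.neg_some, funNeg_yFun]
        ring
      change pointValuation _ (funNeg E (chart E (-(.some a b h)) 1)) ≤ _
      rw [e]
      apply (Valuation.map_sub _ _ _).trans
      rw [Valuation.map_neg, map_mul]
      apply max_le h1
      exact (mul_le_mul' (pointValuation_algebraMap_le _ _) h0).trans (by rw [one_mul])

theorem pointValuation_funNeg_le (P : E.toAffine.Point) {f : E.toAffine.FunctionField} {n : ℕ}
    (h : f ∈ maxIdealPow (-P) n) : pointValuation P (funNeg E f) ≤ exp (-(n : ℤ)) := by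
  obtain ⟨p, q, hp, hq, rfl⟩ := h
  have h1 := Valuation.aeval_le (v := pointValuation P) (pointValuation_algebraMap_le P)
    (pointValuation_funNeg_chart_le P) hp
  have h2 := Valuation.aeval_eq_one (v := pointValuation P) (pointValuation_algebraMap_le P)
    (pointValuation_funNeg_chart_le P) hq
  have e : ∀ p : MvPolynomial (Fin 2) k, funNeg E (MvPolynomial.aeval (chart E (-P)) p) =
      MvPolynomial.aeval (fun i => funNeg E (chart E (-P) i)) p := by
    intro p
    have : (funNeg E).comp (MvPolynomial.aeval (chart E (-P))) =
        MvPolynomial.aeval (fun i => funNeg E (chart E (-P) i)) := by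
      ext i
      simp
    rw [← this]
    rfl
  rw [map_div₀, e, e, map_div₀, h2, div_one]
  exact h1

/-- Pullback does not lower a non-negative order, and being an involution it cannot raise it either.
Poles are handled by inversion. -/
theorem ord_funNeg (P : E.toAffine.Point) {f : E.toAffine.FunctionField} (hf : f ≠ 0) :
    ord P (funNeg E f) = ord (-P) f := by
  have hσ : ∀ f : E.toAffine.FunctionField, f ≠ 0 → funNeg E f ≠ 0 := fun f hf =>
    (map_ne_zero _).2 hf
  have key : ∀ (P : E.toAffine.Point) (f : E.toAffine.FunctionField), f ≠ 0 → 0 ≤ ord (-P) f →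
      ord (-P) f ≤ ord P (funNeg E f) := by
    intro P f hf h0
    obtain ⟨n, hn⟩ := Int.eq_ofNat_of_zero_le h0
    rw [hn, le_ord_iff P (hσ f hf)]
    apply pointValuation_funNeg_le
    rw [← pointValuation_le_iff, ← le_ord_iff _ hf, hn]
  have key2 : ∀ (P : E.toAffine.Point) (f : E.toAffine.FunctionField), f ≠ 0 → 0 ≤ ord (-P) f →
      ord (-P) f = ord P (funNeg E f) := by
    intro P f hf h0
    have h1 := key P f hf h0
    have h2 := key (-P) (funNeg E f) (hσ f hf) (by rw [neg_neg]; omega)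
    rw [neg_neg, funNeg_funNeg] at h2
    omega
  rcases le_total 0 (ord (-P) f) with h | h
  · exact (key2 P f hf h).symm
  · have := key2 P f⁻¹ (inv_ne_zero hf) (by rw [ord_inv]; omega)
    rw [ord_inv, map_inv₀, ord_inv] at this
    omega

/-! ### The divisor of a rational function has degree zero -/

/-- The relation w · (1/y) = (x/y)³ with w a unit gives ord (1/y) = 3 ord (x/y). As one of the two
coordinates has order 1, it must be x/y. -/
theorem ord_zero_chart : ord (.zero : E.toAffine.Point) (xFun E) = -2 ∧
    ord (.zero : E.toAffine.Point) (yFun E) = -3 := by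
  have hx := xFun_ne_zero E
  have hy := yFun_ne_zero E
  have h0 := pointValuation_chart_le (.zero : E.toAffine.Point) 0
  have h1 := pointValuation_chart_le (.zero : E.toAffine.Point) 1
  obtain ⟨i, hi⟩ := exists_pointValuation_chart (.zero : E.toAffine.Point)
  have hi := ord_eq_of_pointValuation hi
  rw [← le_ord_iff _ (chart_ne_zero _ _)] at h0 h1
  let w : MvPolynomial (Fin 2) k := 1 + MvPolynomial.C E.a₁ * MvPolynomial.X 0 +
    MvPolynomial.C E.a₃ * MvPolynomial.X 1 - MvPolynomial.C E.a₂ * MvPolynomial.X 0 ^ 2 -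
    MvPolynomial.C E.a₄ * MvPolynomial.X 0 * MvPolynomial.X 1 -
    MvPolynomial.C E.a₆ * MvPolynomial.X 1 ^ 2
  have hw : pointValuation .zero (MvPolynomial.aeval (chart E .zero) w) = 1 :=
    Valuation.aeval_eq_one (pointValuation_algebraMap_le _) (pointValuation_chart_le _)
      (by simp [w])
  have hw0 : MvPolynomial.aeval (chart E .zero) w ≠ 0 := by
    intro e
    simp [e] at hw
  have hw' := ord_eq_of_pointValuation (n := 0) (by simpa using hw)
  have e : MvPolynomial.aeval (chart E .zero) w * chart E .zero 1 = chart E .zero 0 ^ 3 := by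
    simp [chart, w]
    field_simp
    linear_combination fun_equation E
  have e1 := congrArg (ord .zero) e
  rw [ord_mul _ hw0 (chart_ne_zero _ _), ord_pow, hw'] at e1
  have e2 : ord .zero (chart E .zero 0) =
      ord .zero (xFun E) - ord .zero (yFun E) := by
    rw [← ord_div _ hx hy]
    rfl
  have e3 : ord .zero (chart E .zero 1) = - ord .zero (yFun E) := by
    rw [← ord_inv, ← one_div]
    rfl
  fin_cases i
  · simp only [Fin.zero_eta] at hi
    push_cast at e1
    omega
  · simp only [Fin.mk_one] at hi
    push_cast at e1
    omega

theorem ord_zero_xFun_sub (a : k) :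
    ord (.zero : E.toAffine.Point) (xFun E - algebraMap k _ a) = -2 := by
  rw [sub_eq_add_neg, ord_add_eq (xFun_ne_zero E), ord_zero_chart.1]
  rw [ord_neg, ord_algebraMap, ord_zero_chart.1]
  omega

open Classical in
theorem ord_xFun_sub {a b : k} (h : E.toAffine.Nonsingular a b) (P : E.toAffine.Point) :
    ord P (xFun E - algebraMap k _ a) = (if P = .some a b h then 1 else 0) +
      (if P = -.some a b h then 1 else 0) - (if P = .zero then 2 else 0) := by
  cases P with
  | zero =>
    rw [ord_zero_xFun_sub]
    simp [Affine.Point.neg_some]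
  | some a' b' h' =>
    by_cases haa : a' = a
    · subst haa
      have hl := line_mul_line h'.1
      let q : E.toAffine.CoordinateRing := xCoord E ^ 2 + algebraMap k _ a' * xCoord E +
        algebraMap k _ a' ^ 2 + algebraMap k _ E.a₂ * (xCoord E + algebraMap k _ a') +
        algebraMap k _ E.a₄ - algebraMap k _ E.a₁ * yCoord E
      have hq : algebraMap _ E.toAffine.FunctionField q = xFun E ^ 2 + algebraMap k _ a' * xFun E +
        algebraMap k _ a' ^ 2 + algebraMap k _ E.a₂ * (xFun E + algebraMap k _ a') +
        algebraMap k _ E.a₄ - algebraMap k _ E.a₁ * yFun E := by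
        simp [q, algebraMap_xCoord, algebraMap_yCoord, ← IsScalarTower.algebraMap_apply]
      have hxne := xFun_sub_ne_zero E a'
      have hyne := yFun_sub_ne_zero E b'
      have hyne' := yFun_sub_ne_zero E (E.toAffine.negY a' b')
      have hqne : algebraMap _ E.toAffine.FunctionField q ≠ 0 := by
        rintro e
        rw [← hq, e, mul_zero] at hl
        exact mul_ne_zero hyne hyne' hl
      have e := congrArg (ord (.some a' b' h')) hl
      rw [← hq, ord_mul _ hyne hyne', ord_mul _ hxne hqne] at e
      have h0 := pointValuation_chart_le (.some a' b' h') 0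
      have h1 := pointValuation_chart_le (.some a' b' h') 1
      obtain ⟨i, hi⟩ := exists_pointValuation_chart (.some a' b' h')
      have hi := ord_eq_of_pointValuation hi
      rw [← le_ord_iff _ (chart_ne_zero _ _)] at h0 h1
      have c0 : chart E (.some a' b' h') 0 = xFun E - algebraMap k _ a' := rfl
      have c1 : chart E (.some a' b' h') 1 = yFun E - algebraMap k _ b' := rfl
      rw [c0] at h0
      rw [c1] at h1
      have hqn := ord_coord_nonneg h' q
      -- At a 2-torsion point the quadratic factor is a unit, so x - a' has twice the order of y -
      -- b'. Otherwise y - `negY` is a unit and y - b' has at least the order of x - a'. Since one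
      -- coordinate has order 1, x - a' has order 2 or 1 respectively.
      by_cases hb : b' = E.toAffine.negY a' b'
      · have hqz : ord (.some a' b' h') (algebraMap _ E.toAffine.FunctionField q) = 0 := by
          apply ord_coord_eq_zero
          rcases ((Affine.nonsingular_iff _ _).1 h').2 with hh | hh
          · intro e
            apply hh
            simp [q] at e
            linear_combination -e
          · exact absurd hb hh
        rw [hqz, ← hb] at e
        have hP : Affine.Point.some a' b' h' = .some a' b h := by
          have := Affine.Y_eq_of_X_eq h'.1 h.1 rfl
          rcases this with rfl | h2
          · rfl
          · have : b = b' := by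
              rw [hb, h2, Affine.negY_negY]
            subst this
            rfl
        have hP' : Affine.Point.some a' b' h' = -.some a' b h := by
          rw [← hP, Affine.Point.neg_some]
          simp only [Affine.Point.some.injEq, true_and]
          exact hb
        rw [if_pos hP, if_pos hP', if_neg (by simp)]
        fin_cases i
        · replace hi : ord _ (xFun E - algebraMap k _ a') = 1 := hi
          omega
        · replace hi : ord _ (yFun E - algebraMap k _ b') = 1 := hi
          omega
      · have hyz : ord (.some a' b' h') (yFun E - algebraMap k _ (E.toAffine.negY a' b')) = 0 := by
          have := ord_coord_eq_zero h' (r := yCoord E - algebraMap k _ (E.toAffine.negY a' b'))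
            (by simpa [sub_eq_zero] using hb)
          rwa [map_sub, algebraMap_yCoord, ← IsScalarTower.algebraMap_apply] at this
        have h1 : ord (.some a' b' h') (xFun E - algebraMap k _ a') = 1 := by
          fin_cases i
          · exact hi
          · replace hi : ord _ (yFun E - algebraMap k _ b') = 1 := hi
            omega
        rw [h1, if_neg (by simp : ¬ Affine.Point.some a' b' h' = .zero)]
        rcases Affine.Y_eq_of_X_eq h'.1 h.1 rfl with rfl | h2
        · rw [if_pos rfl, if_neg]
          · ring
          · rw [Affine.Point.neg_some]
            simpa using hb
        · have hP' : Affine.Point.some a' b' h' = -.some a' b h := by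
            rw [Affine.Point.neg_some]
            simpa using h2
          rw [if_pos hP', if_neg]
          · ring
          · intro h3
            simp only [Affine.Point.some.injEq, true_and] at h3
            rw [← h3] at h2
            exact hb h2
    · have := ord_coord_eq_zero h' (r := xCoord E - algebraMap k _ a)
        (by simpa [sub_eq_zero] using haa)
      rw [map_sub, algebraMap_xCoord, ← IsScalarTower.algebraMap_apply] at this
      rw [this]
      simp [Affine.Point.neg_some, haa]

end

noncomputable section

variable {k : Type*} [Field k] {E : WeierstrassCurve k}

theorem finite_support_ord_mul {f g : E.toAffine.FunctionField} (hf : f ≠ 0) (hg : g ≠ 0)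
    (h1 : (Function.support fun P => ord P f).Finite)
    (h2 : (Function.support fun P => ord P g).Finite) :
    (Function.support fun P => ord P (f * g)).Finite := by
  refine (h1.union h2).subset fun P hP => ?_
  simp only [Function.mem_support, Set.mem_union, ord_mul P hf hg] at hP ⊢
  omega

theorem finsum_ord_mul {f g : E.toAffine.FunctionField} (hf : f ≠ 0) (hg : g ≠ 0)
    (h1 : (Function.support fun P => ord P f).Finite)
    (h2 : (Function.support fun P => ord P g).Finite) :
    ∑ᶠ P, ord P (f * g) = ∑ᶠ P, ord P f + ∑ᶠ P, ord P g := by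
  rw [← finsum_add_distrib h1 h2]
  exact finsum_congr fun P => ord_mul P hf hg

theorem degree_eq_sum_of_zeros {f : E.toAffine.FunctionField} (hf : f ≠ 0)
    {S : Finset E.toAffine.Point} (hS : ∀ P ∉ S, ord P f ≤ 0) :
    degree f = ∑ P ∈ S, (ord P f).toNat := by
  rw [degree]
  simp only [zeroMult_eq hf]
  refine finsum_eq_sum_of_support_subset _ fun P hP => ?_
  by_contra hPS
  exact hP (Int.toNat_of_nonpos (hS P hPS))

theorem degree_eq_sum {f : E.toAffine.FunctionField} (hf : f ≠ 0) {S : Finset E.toAffine.Point}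
    (hS : (Function.support fun P => ord P f) ⊆ S) :
    degree f = ∑ P ∈ S, (ord P f).toNat :=
  degree_eq_sum_of_zeros hf fun _ hP => (not_not.1 fun h => hP (hS h)).le

theorem neg_ord_add_algebraMap_le (c : k) {f : E.toAffine.FunctionField}
    (hfc : f + algebraMap k _ c ≠ 0) (P : E.toAffine.Point) :
    (-ord P (f + algebraMap k _ c)).toNat ≤ (-ord P f).toNat := by
  have := le_ord_add (P := P) (n := min (ord P f) 0) hfc (Or.inr (min_le_left _ _))
    (Or.inr (by rw [ord_algebraMap]; exact min_le_right _ _))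
  omega

theorem degree_algebraMap (c : k) (hc : c ≠ 0) :
    degree (algebraMap k E.toAffine.FunctionField c) = 0 := by
  rw [degree_eq_sum (by simpa using hc) (S := ∅) (by simp [Function.support])]
  simp

variable [IsAlgClosed k] [E.IsElliptic]

variable (E) in
theorem exists_nonsingular (a : k) : ∃ b, E.toAffine.Nonsingular a b := by
  let p : Polynomial k := Polynomial.X ^ 2 + Polynomial.C (E.a₁ * a + E.a₃) * Polynomial.X -
    Polynomial.C (a ^ 3 + E.a₂ * a ^ 2 + E.a₄ * a + E.a₆)
  have hp : p.degree = 2 := by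
    simp only [p]
    compute_degree!
  obtain ⟨b, hb⟩ := IsAlgClosed.exists_root p (by rw [hp]; exact two_ne_zero)
  refine ⟨b, (Affine.equation_iff_nonsingular).1 ((Affine.equation_iff _ _).2 ?_)⟩
  simp [p, Polynomial.IsRoot] at hb
  linear_combination hb

theorem finsum_ord_xFun_sub (a : k) :
    (Function.support fun P => ord P (xFun E - algebraMap k _ a)).Finite ∧
      ∑ᶠ P, ord P (xFun E - algebraMap k _ a) = 0 := by
  classical
  obtain ⟨b, h⟩ := exists_nonsingular E a
  have hs : (Function.support fun P => ord P (xFun E - algebraMap k _ a)) ⊆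
      (({.some a b h, -.some a b h, .zero} : Finset E.toAffine.Point) :
        Set E.toAffine.Point) := by
    intro P hP
    by_contra hn
    simp only [Finset.coe_insert, Finset.coe_singleton, Set.mem_insert_iff,
      Set.mem_singleton_iff, not_or] at hn
    apply hP
    simp only [ord_xFun_sub h, if_neg hn.1, if_neg hn.2.1, if_neg hn.2.2]
    rfl
  refine ⟨(Finset.finite_toSet _).subset hs, ?_⟩
  rw [finsum_eq_sum_of_support_subset _ hs]
  simp only [ord_xFun_sub h, Finset.sum_sub_distrib, Finset.sum_add_distrib,
    Finset.sum_ite_eq', Finset.mem_insert, Finset.mem_singleton]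
  simp

theorem finsum_ord_aeval_xFun {p : Polynomial k} (hp : p ≠ 0) :
    Polynomial.aeval (xFun E) p ≠ 0 ∧
      (Function.support fun P => ord P (Polynomial.aeval (xFun E) p)).Finite ∧
      ∑ᶠ P, ord P (Polynomial.aeval (xFun E) p) = 0 := by
  have key : ∀ s : Multiset k, Polynomial.aeval (xFun E)
        (s.map fun a => Polynomial.X - Polynomial.C a).prod ≠ 0 ∧
      (Function.support fun P => ord P (Polynomial.aeval (xFun E)
        (s.map fun a => Polynomial.X - Polynomial.C a).prod)).Finite ∧
      ∑ᶠ P, ord P (Polynomial.aeval (xFun E)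
        (s.map fun a => Polynomial.X - Polynomial.C a).prod) = 0 := by
    intro s
    induction s using Multiset.induction with
    | empty => simp [Function.support]
    | cons a s ih =>
      rw [Multiset.map_cons, Multiset.prod_cons, map_mul, map_sub, Polynomial.aeval_X,
        Polynomial.aeval_C]
      have h1 := finsum_ord_xFun_sub (E := E) a
      have h0 := xFun_sub_ne_zero E a
      refine ⟨mul_ne_zero h0 ih.1, finite_support_ord_mul h0 ih.1 h1.1 ih.2.1, ?_⟩
      rw [finsum_ord_mul h0 ih.1 h1.1 ih.2.1, h1.2, ih.2.2, add_zero]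
  have hpe := (IsAlgClosed.splits p).eq_prod_roots
  have hl : algebraMap k E.toAffine.FunctionField p.leadingCoeff ≠ 0 := by simpa using hp
  obtain ⟨k1, k2, k3⟩ := key p.roots
  have hs : (Function.support fun P : E.toAffine.Point => ord P
      (algebraMap k E.toAffine.FunctionField p.leadingCoeff)).Finite := by
    simp [Function.support]
  rw [hpe, map_mul, Polynomial.aeval_C]
  refine ⟨mul_ne_zero hl k1, finite_support_ord_mul hl k1 hs k2, ?_⟩
  rw [finsum_ord_mul hl k1 hs k2, k3]
  simp

/-- At affine points r and its conjugate are both regular, so the zeros of r are among those of its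
norm, a polynomial in x. -/
theorem finite_support_ord_coord {r : E.toAffine.CoordinateRing} (hr : r ≠ 0) :
    (Function.support fun P => ord P (algebraMap _ E.toAffine.FunctionField r)).Finite := by
  obtain ⟨p, hp⟩ := exists_mul_coordNeg r
  have hσ : coordNeg E r ≠ 0 := (map_ne_zero_iff _ coordNeg_injective).2 hr
  have hp0 : p ≠ 0 := by
    rintro rfl
    rw [map_zero] at hp
    exact mul_ne_zero hr hσ hp
  have hp' := congrArg (algebraMap _ E.toAffine.FunctionField) hp
  rw [map_mul, ← Polynomial.aeval_algebraMap_apply, algebraMap_xCoord] at hp'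
  refine ((finsum_ord_aeval_xFun (E := E) hp0).2.1.union (Set.finite_singleton .zero)).subset ?_
  intro P hP
  cases P with
  | zero => right; rfl
  | some a b h =>
    left
    rw [Function.mem_support] at hP ⊢
    rw [← hp', ord_mul _ (by simpa using hr) (by simpa using hσ)]
    have h1 := ord_coord_nonneg h r
    have h2 := ord_coord_nonneg h (coordNeg E r)
    omega

theorem finite_support_ord (f : E.toAffine.FunctionField) :
    (Function.support fun P => ord P f).Finite := by
  rcases eq_or_ne f 0 with rfl | hf
  · simp [Function.support]
  obtain ⟨a, b, hb, rfl⟩ := IsFractionRing.div_surjective E.toAffine.CoordinateRing f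
  have hb0 := nonZeroDivisors.ne_zero hb
  have ha0 : a ≠ 0 := by
    rintro rfl
    simp at hf
  refine ((finite_support_ord_coord ha0).union (finite_support_ord_coord hb0)).subset ?_
  intro P hP
  simp only [Function.mem_support, Set.mem_union] at hP ⊢
  rw [ord_div _ (by simpa using ha0) (by simpa using hb0)] at hP
  omega

/-- The divisor of a rational function has degree zero. -/
theorem finsum_ord {f : E.toAffine.FunctionField} (hf : f ≠ 0) : ∑ᶠ P, ord P f = 0 := by
  have hR : ∀ r : E.toAffine.CoordinateRing, r ≠ 0 →
      ∑ᶠ P, ord P (algebraMap _ E.toAffine.FunctionField r) = 0 := by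
    intro r hr
    obtain ⟨p, hp⟩ := exists_mul_coordNeg r
    have hσ : coordNeg E r ≠ 0 := (map_ne_zero_iff _ coordNeg_injective).2 hr
    have hp0 : p ≠ 0 := by
      rintro rfl
      rw [map_zero] at hp
      exact mul_ne_zero hr hσ hp
    have hp' := congrArg (algebraMap _ E.toAffine.FunctionField) hp
    rw [map_mul, ← Polynomial.aeval_algebraMap_apply, algebraMap_xCoord] at hp'
    have h1 := (finsum_ord_aeval_xFun (E := E) hp0).2.2
    have hr' : algebraMap _ E.toAffine.FunctionField r ≠ 0 := by simpa using hr
    rw [← hp', finsum_ord_mul hr' (by simpa using hσ) (finite_support_ord _)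
      (finite_support_ord _)] at h1
    -- Negation permutes the points, so r and its conjugate have the same total order. Twice that
    -- total is the total order of the norm, which is 0.
    have h2 : ∑ᶠ P, ord P (algebraMap _ E.toAffine.FunctionField (coordNeg E r)) =
        ∑ᶠ P, ord P (algebraMap _ E.toAffine.FunctionField r) := by
      rw [← finsum_comp_equiv (Equiv.neg E.toAffine.Point)
        (f := fun P => ord P (algebraMap _ E.toAffine.FunctionField r))]
      refine finsum_congr fun P => ?_
      rw [← funNeg_algebraMap, ord_funNeg P hr']
      rfl
    omega
  obtain ⟨a, b, hb, rfl⟩ := IsFractionRing.div_surjective E.toAffine.CoordinateRing f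
  have hb0 := nonZeroDivisors.ne_zero hb
  have ha0 : a ≠ 0 := by
    rintro rfl
    simp at hf
  have h := finsum_ord_mul hf (g := algebraMap _ E.toAffine.FunctionField b) (by simpa using hb0)
    (finite_support_ord _) (finite_support_ord _)
  rw [div_mul_cancel₀ _ (by simpa using hb0), hR a ha0, hR b hb0] at h
  omega

theorem exists_pole_of_zero {f : E.toAffine.FunctionField} (hf : f ≠ 0) {P : E.toAffine.Point}
    (hP : 0 < ord P f) : ∃ Q, ord Q f < 0 := by
  by_contra! h
  have h1 := finsum_ord hf
  have := finsum_pos (f := fun P => ord P f) h ⟨P, hP⟩ (finite_support_ord f)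
  omega

/-- After subtracting the value at infinity, a non-zero difference would have a zero but no pole. -/
theorem eq_algebraMap_of_ord_nonneg {f : E.toAffine.FunctionField} (h : ∀ P, 0 ≤ ord P f) :
    ∃ c : k, f = algebraMap k _ c := by
  obtain ⟨c, hc⟩ := exists_ord_sub_pos (h .zero)
  refine ⟨c, hc.resolve_right fun hpos => ?_⟩
  have hne : f - algebraMap k _ c ≠ 0 := by
    intro e
    simp [e] at hpos
  obtain ⟨Q, hQ⟩ := exists_pole_of_zero hne hpos
  have : 0 ≤ ord Q (f - algebraMap k _ c) := by
    rw [sub_eq_add_neg] at hne ⊢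
    refine le_ord_add hne (Or.inr (h Q)) (Or.inr ?_)
    rw [ord_neg, ord_algebraMap]
  omega

/-! ### Degrees -/

theorem degree_inv {f : E.toAffine.FunctionField} (hf : f ≠ 0) : degree f⁻¹ = degree f := by
  have hS : (Function.support fun P => ord P f) ⊆ ((finite_support_ord f).toFinset :
      Set E.toAffine.Point) := by simp
  have hS' : (Function.support fun P => ord P f⁻¹) ⊆ ((finite_support_ord f).toFinset :
      Set E.toAffine.Point) := by simp
  have h := finsum_ord hf
  rw [finsum_eq_sum_of_support_subset _ hS] at h
  rw [degree_eq_sum hf hS, degree_eq_sum (inv_ne_zero hf) hS']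
  zify
  rw [← sub_eq_zero, ← Finset.sum_sub_distrib, ← neg_eq_zero, ← Finset.sum_neg_distrib, ← h]
  refine Finset.sum_congr rfl fun P _ => ?_
  rw [ord_inv]
  omega

theorem degree_eq_sum_poles {f : E.toAffine.FunctionField} (hf : f ≠ 0)
    {S : Finset E.toAffine.Point} (hS : (Function.support fun P => ord P f) ⊆ S) :
    degree f = ∑ P ∈ S, (-ord P f).toNat := by
  rw [← degree_inv hf, degree_eq_sum (inv_ne_zero hf) (S := S) (by simpa using hS)]
  simp

/-- Degrees are compared through poles because the poles of sums and translates, unlike their zeros,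
can be bounded point by point. -/
theorem degree_le_mul_of_poles {f g : E.toAffine.FunctionField} (hf : f ≠ 0) (hg : g ≠ 0) {m : ℕ}
    (h : ∀ P, (-ord P g).toNat ≤ m * (-ord P f).toNat) : degree g ≤ m * degree f := by
  classical
  let S := (finite_support_ord f).toFinset ∪ (finite_support_ord g).toFinset
  rw [degree_eq_sum_poles hf (S := S) (by simp [S]), degree_eq_sum_poles hg (S := S) (by simp [S]),
    Finset.mul_sum]
  exact Finset.sum_le_sum fun P _ => h P

theorem degree_le_of_poles {f g : E.toAffine.FunctionField} (hf : f ≠ 0) (hg : g ≠ 0)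
    (h : ∀ P, (-ord P g).toNat ≤ (-ord P f).toNat) : degree g ≤ degree f := by
  simpa using degree_le_mul_of_poles hf hg (m := 1) (by simpa using h)

theorem degree_algebraMap_mul {c : k} (hc : c ≠ 0) {f : E.toAffine.FunctionField} (hf : f ≠ 0) :
    degree (algebraMap k _ c * f) = degree f := by
  have hc' : algebraMap k E.toAffine.FunctionField c ≠ 0 := by simpa using hc
  have h : ∀ P, ord P (algebraMap k _ c * f) = ord P f := fun P => by
    rw [ord_mul P hc' hf, ord_algebraMap, zero_add]
  apply le_antisymm <;> apply degree_le_of_poles <;> simp [hf, hc, h]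

theorem degree_add_algebraMap (c : k) {f : E.toAffine.FunctionField} (hf : f ≠ 0)
    (hfc : f + algebraMap k _ c ≠ 0) : degree (f + algebraMap k _ c) = degree f := by
  refine le_antisymm (degree_le_of_poles hf hfc (neg_ord_add_algebraMap_le c hfc)) ?_
  have e : f + algebraMap k _ c + algebraMap k _ (-c) = f := by simp
  have := degree_le_of_poles hfc (g := f + algebraMap k _ c + algebraMap k _ (-c)) (by rwa [e])
    (neg_ord_add_algebraMap_le (-c) (by rwa [e]))
  rwa [e] at this

theorem degree_sub_algebraMap (c : k) {f : E.toAffine.FunctionField} (hf : f ≠ 0)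
    (hfc : f - algebraMap k _ c ≠ 0) : degree (f - algebraMap k _ c) = degree f := by
  have := degree_add_algebraMap (-c) hf (by rwa [map_neg, ← sub_eq_add_neg])
  rwa [map_neg, ← sub_eq_add_neg] at this

theorem degree_pow {f : E.toAffine.FunctionField} (hf : f ≠ 0) (m : ℕ) :
    degree (f ^ m) = m * degree f := by
  rw [degree_eq_sum hf (S := (finite_support_ord f).toFinset) (by simp),
    degree_eq_sum (pow_ne_zero m hf) (S := (finite_support_ord f).toFinset)
      (by intro P hP; simp at hP ⊢; exact hP.2), Finset.mul_sum]
  refine Finset.sum_congr rfl fun P _ => ?_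
  rw [ord_pow]
  rcases le_total 0 (ord P f) with h | h
  · rw [Int.toNat_mul (Int.natCast_nonneg m) h, Int.toNat_natCast]
  · rw [Int.toNat_of_nonpos h, Int.toNat_of_nonpos (mul_nonpos_of_nonneg_of_nonpos
      (Int.natCast_nonneg m) h), mul_zero]

theorem degree_geom_sum_le {f : E.toAffine.FunctionField} (hf : f ≠ 0) (m : ℕ)
    (h : ∑ i ∈ Finset.range (m + 1), f ^ i ≠ 0) :
    degree (∑ i ∈ Finset.range (m + 1), f ^ i) ≤ m * degree f := by
  refine degree_le_mul_of_poles hf h fun P => ?_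
  have key : ∀ m : ℕ, ∑ i ∈ Finset.range (m + 1), f ^ i = 0 ∨
      -((m * (-ord P f).toNat : ℕ) : ℤ) ≤ ord P (∑ i ∈ Finset.range (m + 1), f ^ i) := by
    intro m
    induction m with
    | zero => simp
    | succ m ih =>
      rw [Finset.sum_range_succ]
      rw [or_iff_not_imp_left]
      intro hne
      refine le_ord_add hne (ih.imp_right fun h => h.trans' ?_) (Or.inr ?_)
      · rw [ord_pow]
        push_cast
        nlinarith [Int.self_le_toNat (-ord P f)]
      · rw [neg_le_neg_iff, Nat.cast_le]
        gcongr
        omega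
  have := (key m).resolve_left h
  omega

end

end EllipticFunction

/-! ### The five-term relation as a membership criterion. -/

namespace PreBloch

variable {F : Type*} [Field F]

theorem fiveTerm_relation (x y : PreBlochGen F) (h : x ≠ y) :
    symbol x - symbol y + symbol (PreBlochGen.quot x y h) + symbol (PreBlochGen.oneSubQuot x y h) -
      symbol (PreBlochGen.oneSubInvQuot x y h) = 0 := by
  have : QuotientAddGroup.mk' (fiveTermSubgroup F) (PreBlochGen.fiveTerm x y h) = 0 :=
    (QuotientAddGroup.eq_zero_iff _).2 (AddSubgroup.subset_closure ⟨x, y, h, rfl⟩)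
  simpa [PreBlochGen.fiveTerm, symbol] using this

/-- The class of `x` lies in a subgroup containing the other four classes of a five-term
relation. -/
theorem symbol_left_mem {H : AddSubgroup (PreBloch F)} (x y : PreBlochGen F) (h : x ≠ y)
    (h1 : symbol y ∈ H) (h2 : symbol (PreBlochGen.quot x y h) ∈ H)
    (h3 : symbol (PreBlochGen.oneSubQuot x y h) ∈ H)
    (h4 : symbol (PreBlochGen.oneSubInvQuot x y h) ∈ H) : symbol x ∈ H := by
  have e : symbol x = symbol y - symbol (PreBlochGen.quot x y h) -
      symbol (PreBlochGen.oneSubQuot x y h) + symbol (PreBlochGen.oneSubInvQuot x y h) := by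
    rw [← sub_eq_zero, ← fiveTerm_relation x y h]
    abel
  rw [e]
  exact H.add_mem (H.sub_mem (H.sub_mem h1 h2) h3) h4

/-- The class of `y` lies in a subgroup containing the other four classes of a five-term
relation. -/
theorem symbol_right_mem {H : AddSubgroup (PreBloch F)} (x y : PreBlochGen F) (h : x ≠ y)
    (h1 : symbol x ∈ H) (h2 : symbol (PreBlochGen.quot x y h) ∈ H)
    (h3 : symbol (PreBlochGen.oneSubQuot x y h) ∈ H)
    (h4 : symbol (PreBlochGen.oneSubInvQuot x y h) ∈ H) : symbol y ∈ H := by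
  have e : symbol y = symbol x + symbol (PreBlochGen.quot x y h) +
      symbol (PreBlochGen.oneSubQuot x y h) - symbol (PreBlochGen.oneSubInvQuot x y h) := by
    rw [← sub_eq_zero, ← neg_eq_zero, ← fiveTerm_relation x y h]
    abel
  rw [e]
  exact H.sub_mem (H.add_mem (H.add_mem h1 h2) h3) h4

end PreBloch

/-! ### Classes of proper powers. -/

namespace EllipticFunction

open WeierstrassCurve

noncomputable section

variable {k : Type*} [Field k] {E : WeierstrassCurve k}

theorem symbol_mem_filtration {f : PreBlochGen E.toAffine.FunctionField} {n : ℕ}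
    (h : degree f.1 ≤ n) : PreBloch.symbol f ∈ filtration E n :=
  AddSubgroup.subset_closure ⟨f, h, rfl⟩

variable [IsAlgClosed k] [E.IsElliptic]

/-- The class of a power `e ^ (m + 1)` is a combination of classes of functions of lower degree. -/
theorem symbol_pow_mem {e : E.toAffine.FunctionField} {m n : ℕ} (hm : 1 ≤ m) (hd : 0 < degree e)
    (f : PreBlochGen E.toAffine.FunctionField) (hf : f.1 = e ^ (m + 1))
    (hn : m * degree e ≤ n) : PreBloch.symbol f ∈ filtration E n := by
  have he0 : e ≠ 0 := by
    rintro rfl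
    exact f.2.1 (by rw [hf]; simp)
  have he1 : e ≠ 1 := by
    rintro rfl
    exact f.2.2 (by rw [hf]; simp)
  have hne : (⟨e, he0, he1⟩ : PreBlochGen E.toAffine.FunctionField) ≠ f := by
    intro h
    have h1 : degree (e ^ (m + 1)) = degree e := by rw [← hf, ← h]
    rw [degree_pow he0] at h1
    nlinarith
  have hg : (∑ i ∈ Finset.range (m + 1), e ^ i) * (1 - e) = 1 - e ^ (m + 1) := by
    have := geom_sum_mul e (m + 1)
    linear_combination -this
  have hf1 : 1 - e ^ (m + 1) ≠ 0 := sub_ne_zero.2 fun h => f.2.2 (by rw [hf, ← h])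
  have hs0 : ∑ i ∈ Finset.range (m + 1), e ^ i ≠ 0 := by
    intro h
    rw [h, zero_mul] at hg
    exact hf1 hg.symm
  have hei1 : 1 - e⁻¹ ≠ 0 := sub_ne_zero.2 fun h => he1 (inv_eq_one.1 h.symm)
  have hg' : (∑ i ∈ Finset.range (m + 1), e⁻¹ ^ i) * (1 - e⁻¹) = 1 - (e ^ (m + 1))⁻¹ := by
    have := geom_sum_mul e⁻¹ (m + 1)
    rw [inv_pow] at this
    linear_combination -this
  have hf1' : 1 - (e ^ (m + 1))⁻¹ ≠ 0 := sub_ne_zero.2 fun h => f.2.2 (by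
    rw [hf]; exact inv_eq_one.1 h.symm)
  have hs0' : ∑ i ∈ Finset.range (m + 1), e⁻¹ ^ i ≠ 0 := by
    intro h
    rw [h, zero_mul] at hg'
    exact hf1' hg'.symm
  have he1' : 1 - e ≠ 0 := sub_ne_zero.2 he1.symm
  -- For x = e and y = e ^ (m + 1), the other three arguments are e ^ m and the inverses of 1 + e +
  -- ⋯ + e ^ m and of the same sum in e⁻¹.
  apply PreBloch.symbol_right_mem ⟨e, he0, he1⟩ f hne <;> apply symbol_mem_filtration
  · exact le_trans (Nat.le_mul_of_pos_left _ hm) hn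
  · rw [show (PreBlochGen.quot ⟨e, he0, he1⟩ f hne).1 = e ^ m by
      change f.1 / e = _
      rw [hf, pow_succ, mul_div_cancel_right₀ _ he0], degree_pow he0]
    exact hn
  · rw [show (PreBlochGen.oneSubQuot ⟨e, he0, he1⟩ f hne).1 =
      (∑ i ∈ Finset.range (m + 1), e ^ i)⁻¹ by
        change (1 - e) / (1 - f.1) = _
        rw [hf, ← hg]
        field_simp, degree_inv hs0]
    exact (degree_geom_sum_le he0 m hs0).trans hn
  · rw [show (PreBlochGen.oneSubInvQuot ⟨e, he0, he1⟩ f hne).1 =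
      (∑ i ∈ Finset.range (m + 1), e⁻¹ ^ i)⁻¹ by
        change (1 - e⁻¹) / (1 - f.1⁻¹) = _
        rw [hf, ← hg', div_eq_iff (mul_ne_zero hs0' hei1), inv_mul_cancel_left₀ hs0'],
      degree_inv hs0']
    refine (degree_geom_sum_le (inv_ne_zero he0) m hs0').trans ?_
    rwa [degree_inv he0]

end

noncomputable section

variable {k : Type*} [Field k] {E : WeierstrassCurve k}

/-! ### The invariant derivation and ramification -/

variable (E) in
/-- The homomorphism to the dual numbers over the coordinate ring which corresponds to the
invariant derivation. -/
def coordDualHom : E.toAffine.CoordinateRing →ₐ[k] DualNumber E.toAffine.CoordinateRing :=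
  coordLift
    -- With F the Weierstrass polynomial, x is sent to x + εF_y and y to y - εF_x. The ε-part of the
    -- equation then cancels.
    (TrivSqZeroExt.inl (xCoord E) + TrivSqZeroExt.inr
      (2 * yCoord E + algebraMap k _ E.a₁ * xCoord E + algebraMap k _ E.a₃))
    (TrivSqZeroExt.inl (yCoord E) + TrivSqZeroExt.inr
      (3 * xCoord E ^ 2 + 2 * algebraMap k _ E.a₂ * xCoord E + algebraMap k _ E.a₄ -
        algebraMap k _ E.a₁ * yCoord E)) (by
    have hA : ∀ a : k, algebraMap k (DualNumber E.toAffine.CoordinateRing) a =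
      TrivSqZeroExt.inl (algebraMap k _ a) := fun _ => rfl
    ext
    · simp [hA]
      linear_combination coord_equation E
    · simp [hA, TrivSqZeroExt.snd_pow]
      ring)

theorem fst_coordDualHom (r : E.toAffine.CoordinateRing) : (coordDualHom E r).fst = r := by
  obtain ⟨p, q, rfl⟩ := exists_polynomial_coord E r
  have h : ∀ s, (coordDualHom E s).fst = ((TrivSqZeroExt.fstHom k E.toAffine.CoordinateRing
    E.toAffine.CoordinateRing).comp (coordDualHom E)) s := fun _ => rfl
  rw [h, map_add, map_mul, ← Polynomial.aeval_algHom_apply, ← Polynomial.aeval_algHom_apply,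
    ← h, ← h]
  simp [coordDualHom]

variable (E) in
/-- The invariant derivation of the coordinate ring. -/
def coordDeriv : Derivation k E.toAffine.CoordinateRing E.toAffine.CoordinateRing :=
  Derivation.mk' (((TrivSqZeroExt.sndHom _ _).restrictScalars k) ∘ₗ (coordDualHom E).toLinearMap) (by
    intro r s
    simp [TrivSqZeroExt.snd_mul, fst_coordDualHom, mul_comm])

theorem coordDeriv_xCoord : coordDeriv E (xCoord E) =
    2 * yCoord E + algebraMap k _ E.a₁ * xCoord E + algebraMap k _ E.a₃ := by
  change (coordDualHom E (xCoord E)).snd = _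
  simp [coordDualHom]

theorem coordDeriv_yCoord : coordDeriv E (yCoord E) =
    3 * xCoord E ^ 2 + 2 * algebraMap k _ E.a₂ * xCoord E + algebraMap k _ E.a₄ -
        algebraMap k _ E.a₁ * yCoord E := by
  change (coordDualHom E (yCoord E)).snd = _
  simp [coordDualHom]

theorem exists_coord_div {a b : k} (h : E.toAffine.Nonsingular a b) {f : E.toAffine.FunctionField}
    {n : ℕ} (hf : pointValuation (.some a b h) f ≤ exp (-(n : ℤ))) :
    ∃ (p : MvPolynomial (Fin 2) k) (r : E.toAffine.CoordinateRing),
      p ∈ (Ideal.span {MvPolynomial.X 0, MvPolynomial.X 1} : Ideal (MvPolynomial (Fin 2) k)) ^ n ∧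
      evalAt h r ≠ 0 ∧
      algebraMap _ _ r * f = algebraMap _ _ (MvPolynomial.aeval (coordChart h) p) := by
  obtain ⟨p, q, hp, hq, rfl⟩ := (pointValuation_le_iff _ n f).1 hf
  refine ⟨p, MvPolynomial.aeval (coordChart h) q, hp, by rwa [evalAt_aeval_coordChart], ?_⟩
  rw [algebraMap_aeval_coordChart, algebraMap_aeval_coordChart, mul_div_cancel₀]
  exact fun e => hq (constantCoeff_eq_zero_of_aeval_chart e)

/-- A derivation maps 𝔪² into 𝔪. The denominator q does no harm: the Leibniz rule for q * r leaves
only q · Dr at the point, as r vanishes there. -/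
theorem evalAt_coordDeriv_eq_zero {a b : k} (h : E.toAffine.Nonsingular a b)
    {r : E.toAffine.CoordinateRing} (hr : 2 ≤ ord (.some a b h) (algebraMap _ _ r)) :
    evalAt h (coordDeriv E r) = 0 := by
  have hr0 : r ≠ 0 := by
    rintro rfl
    simp at hr
  have hev : evalAt h r = 0 := by
    by_contra hne
    rw [ord_coord_eq_zero h hne] at hr
    omega
  obtain ⟨p, q, hp, hq, e⟩ := exists_coord_div h (n := 2)
    ((le_ord_iff _ (by simpa using hr0) 2).1 hr)
  rw [← map_mul] at e
  have e' := FaithfulSMul.algebraMap_injective _ _ e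
  have key : evalAt h (coordDeriv E (MvPolynomial.aeval (coordChart h) p)) = 0 := by
    clear e e'
    rw [pow_two] at hp
    induction hp using Submodule.mul_induction_on' with
    | mem_mul_mem s hs t ht =>
      have h1 := MvPolynomial.constantCoeff_eq_zero_of_mem hs
      have h2 := MvPolynomial.constantCoeff_eq_zero_of_mem ht
      rw [← evalAt_aeval_coordChart h] at h1 h2
      rw [map_mul, Derivation.leibniz, map_add, smul_eq_mul, smul_eq_mul, map_mul, map_mul, h1, h2]
      simp
    | add s _ t _ hs ht => simp only [map_add, hs, ht, add_zero]
  rw [← e', Derivation.leibniz, map_add, smul_eq_mul, smul_eq_mul, map_mul, map_mul, hev, zero_mul,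
    add_zero] at key
  exact (mul_eq_zero.1 key).resolve_left hq

/-- The derivation takes the two coordinates to the partial derivatives of the Weierstrass equation,
up to sign, so nonsingularity makes one of these values non-zero. That coordinate then cannot have
order 2 or more. -/
theorem exists_uniformizer {a b : k} (h : E.toAffine.Nonsingular a b) :
    ∃ t : E.toAffine.CoordinateRing, ord (.some a b h) (algebraMap _ _ t) = 1 ∧
      evalAt h (coordDeriv E t) ≠ 0 := by
  have key : ∃ i, evalAt h (coordDeriv E (coordChart h i)) ≠ 0 := by
    rcases ((Affine.nonsingular_iff _ _).1 h).2 with h' | h'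
    · refine ⟨1, fun e => h' ?_⟩
      simp [coordChart, coordDeriv_yCoord, map_ofNat (evalAt h)] at e
      linear_combination -e
    · refine ⟨0, fun e => h' ?_⟩
      simp [coordChart, coordDeriv_xCoord, map_ofNat (evalAt h)] at e
      linear_combination e
  obtain ⟨i, hi⟩ := key
  refine ⟨coordChart h i, le_antisymm ?_ ?_, hi⟩
  · by_contra hlt
    exact hi (evalAt_coordDeriv_eq_zero h (by omega))
  · rw [algebraMap_coordChart, le_ord_iff _ (chart_ne_zero _ _)]
    exact pointValuation_chart_le _ _

variable [IsAlgClosed k] [E.IsElliptic] in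
variable (E) in
theorem exists_affine_notMem {S : Set E.toAffine.Point} (hS : S.Finite) :
    ∃ (a b : k) (h : E.toAffine.Nonsingular a b), .some a b h ∉ S := by
  choose b hb using exists_nonsingular E
  have hinj : Function.Injective fun a => Affine.Point.some a (b a) (hb a) := by
    intro a a' e
    simp only [Affine.Point.some.injEq] at e
    exact e.1
  obtain ⟨a, ha⟩ := (hS.preimage hinj.injOn).exists_notMem
  exact ⟨a, b a, hb a, ha⟩

variable [CharZero k]

/-- Differentiate r = t ^ (n + 1) · (unit): the leading term is (n + 1) t ^ n Dt · (unit), and n + 1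
≠ 0 in characteristic 0. To stay inside the coordinate ring, the unit is written s/q and the
equation q * r = t ^ (n + 1) * s is differentiated. -/
theorem ord_coordDeriv {a b : k} (h : E.toAffine.Nonsingular a b)
    {r : E.toAffine.CoordinateRing} (hr0 : r ≠ 0) (hr : evalAt h r = 0) :
    coordDeriv E r ≠ 0 ∧ ord (.some a b h) (algebraMap _ _ (coordDeriv E r)) =
      ord (.some a b h) (algebraMap _ _ r) - 1 := by
  obtain ⟨t, ht, hDt⟩ := exists_uniformizer h
  have ht0 : t ≠ 0 := by
    rintro rfl
    simp at ht
  have hpos := ord_coord_pos h hr0 hr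
  obtain ⟨n, hn⟩ : ∃ n : ℕ, ord (.some a b h) (algebraMap _ _ r) = n + 1 :=
    ⟨(ord (.some a b h) (algebraMap _ _ r) - 1).toNat, by omega⟩
  have inj : ∀ s : E.toAffine.CoordinateRing, s ≠ 0 →
    algebraMap _ E.toAffine.FunctionField s ≠ 0 := fun s hs => by simpa using hs
  have hu : ord (.some a b h) (algebraMap _ _ r / algebraMap _ _ t ^ (n + 1)) = 0 := by
    rw [ord_div _ (inj r hr0) (pow_ne_zero _ (inj t ht0)), ord_pow, ht, hn]
    push_cast
    ring
  have hu0 : algebraMap _ E.toAffine.FunctionField r / algebraMap _ _ t ^ (n + 1) ≠ 0 :=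
    div_ne_zero (inj r hr0) (pow_ne_zero _ (inj t ht0))
  obtain ⟨p, q, -, hq, e⟩ := exists_coord_div h (n := 0)
    ((le_ord_iff _ hu0 0).1 hu.ge)
  set s := MvPolynomial.aeval (coordChart h) p with hs
  have hq0 : q ≠ 0 := by
    rintro rfl
    simp at hq
  have hs0 : s ≠ 0 := by
    intro hs0
    rw [hs0, map_zero] at e
    exact mul_ne_zero (inj q hq0) hu0 e
  have hos : ord (.some a b h) (algebraMap _ _ s) = 0 := by
    rw [← e, ord_mul _ (inj q hq0) hu0, hu, ord_coord_eq_zero h hq, add_zero]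
  have hev : evalAt h s ≠ 0 := by
    intro he
    have := ord_coord_pos h hs0 he
    omega
  have e2 : q * r = t ^ (n + 1) * s := by
    apply FaithfulSMul.algebraMap_injective _ E.toAffine.FunctionField
    rw [map_mul, map_mul, map_pow, ← e]
    have := pow_ne_zero (n + 1) (inj t ht0)
    field_simp
  have e3 := congrArg (coordDeriv E) e2
  rw [Derivation.leibniz, Derivation.leibniz, Derivation.leibniz_pow] at e3
  simp only [smul_eq_mul, nsmul_eq_mul, Nat.add_sub_cancel] at e3
  let A : E.toAffine.CoordinateRing := s * ((n + 1 : ℕ) * (t ^ n * coordDeriv E t))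
  have hA0 : evalAt h (s * ((n + 1 : ℕ) * coordDeriv E t)) ≠ 0 := by
    rw [map_mul, map_mul, map_natCast]
    exact mul_ne_zero hev (mul_ne_zero (Nat.cast_ne_zero.2 n.succ_ne_zero) hDt)
  have hAe : A = t ^ n * (s * ((n + 1 : ℕ) * coordDeriv E t)) := by
    simp only [A]; ring
  have hA1 : s * ((n + 1 : ℕ) * coordDeriv E t) ≠ 0 := by
    intro h0
    rw [h0, map_zero] at hA0
    exact hA0 rfl
  have hAne : A ≠ 0 := by
    rw [hAe]
    exact mul_ne_zero (pow_ne_zero _ ht0) hA1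
  have hAord : ord (.some a b h) (algebraMap _ _ A) = n := by
    rw [hAe, map_mul, ord_mul _ (inj _ (pow_ne_zero _ ht0)) (inj _ hA1), map_pow, ord_pow, ht,
      ord_coord_eq_zero h hA0]
    ring
  -- `A` is the leading term, of order exactly n; the remainder `B` vanishes to higher order.
  let B : E.toAffine.CoordinateRing := t ^ (n + 1) * coordDeriv E s - r * coordDeriv E q
  have hB : B = 0 ∨ (n + 1 : ℤ) ≤ ord (.some a b h) (algebraMap _ _ B) := by
    rw [or_iff_not_imp_left]
    intro hB
    have hB' := inj B hB
    simp only [B, sub_eq_add_neg, map_add, map_neg, map_mul, map_pow] at hB' ⊢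
    have hD := ord_coord_nonneg h (coordDeriv E s)
    have hD' := ord_coord_nonneg h (coordDeriv E q)
    refine le_ord_add hB' ?_ ?_
    · rw [or_iff_not_imp_left]
      intro h0
      rw [ord_mul _ (left_ne_zero_of_mul h0) (right_ne_zero_of_mul h0), ord_pow, ht]
      push_cast
      omega
    · rw [or_iff_not_imp_left, neg_eq_zero, ord_neg]
      intro h0
      rw [ord_mul _ (left_ne_zero_of_mul h0) (right_ne_zero_of_mul h0), hn]
      omega
  have hAB : q * coordDeriv E r = A + B := by
    simp only [A, B]
    linear_combination e3
  have hABord : ord (.some a b h) (algebraMap _ _ (q * coordDeriv E r)) = n := by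
    rw [hAB, map_add, ord_add_eq (inj A hAne), hAord]
    rw [hAord]
    refine hB.imp (fun h0 => by rw [h0, map_zero]) fun h1 => by omega
  have hne : coordDeriv E r ≠ 0 := by
    intro h0
    rw [h0, mul_zero, eq_comm] at hAB
    have hBA : B = -A := by linear_combination hAB
    rw [hBA, map_neg, ord_neg, hAord, neg_eq_zero] at hB
    exact hB.elim hAne (by omega)
  refine ⟨hne, ?_⟩
  rw [map_mul, ord_mul _ (inj q hq0) (inj _ hne), ord_coord_eq_zero h hq] at hABord
  omega

variable [IsAlgClosed k] [E.IsElliptic]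

/-- A non-constant function is ramified at finitely many points only. -/
theorem finite_ramification {f : E.toAffine.FunctionField} (hf : ∀ c, f ≠ algebraMap k _ c) :
    {P | ∃ c, 2 ≤ ord P (f - algebraMap k _ c)}.Finite := by
  obtain ⟨g, h, hh, rfl⟩ := IsFractionRing.div_surjective E.toAffine.CoordinateRing f
  have hh0 := nonZeroDivisors.ne_zero hh
  have inj : ∀ s : E.toAffine.CoordinateRing, s ≠ 0 →
    algebraMap _ E.toAffine.FunctionField s ≠ 0 := fun s hs => by simpa using hs
  have hsub : ∀ c : k, algebraMap _ E.toAffine.FunctionField g / algebraMap _ _ h -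
      algebraMap k _ c = algebraMap _ _ (g - algebraMap k _ c * h) / algebraMap _ _ h := by
    intro c
    have := inj h hh0
    rw [map_sub, map_mul, ← IsScalarTower.algebraMap_apply]
    field_simp
  have hr0 : ∀ c : k, g - algebraMap k _ c * h ≠ 0 := by
    intro c hc
    have := hsub c
    rw [hc, map_zero, zero_div, sub_eq_zero] at this
    exact hf c this
  have heval : ∀ {a b : k} (hP : E.toAffine.Nonsingular a b),
      ord (.some a b hP) (algebraMap _ _ h) = 0 → evalAt hP h ≠ 0 := by
    intro a b hP h0 he
    have := ord_coord_pos hP hh0 he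
    omega
  -- The numerator of the derivative of g/h. It is unchanged when g is replaced by g - c h, so it
  -- vanishes at each affine ramification point at which h has order 0, and it remains to see that
  -- it is not identically zero.
  let W := h * coordDeriv E g - g * coordDeriv E h
  have hW : ∀ c : k, W = h * coordDeriv E (g - algebraMap k _ c * h) -
      (g - algebraMap k _ c * h) * coordDeriv E h := by
    intro c
    simp only [W, map_sub, Derivation.leibniz, Derivation.map_algebraMap, smul_eq_mul]
    ring
  -- At an affine point where h does not vanish, let c be the value of g/h. The first term of `W`
  -- has order one less than g - c h, while the second, if non-zero, has at least that order.
  have hW0 : W ≠ 0 := by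
    obtain ⟨a, b, hP, hPS⟩ := exists_affine_notMem E
      (finite_support_ord (algebraMap _ E.toAffine.FunctionField h))
    rw [Function.notMem_support] at hPS
    have hev := heval hP hPS
    let c := evalAt hP g / evalAt hP h
    have hrc : evalAt hP (g - algebraMap k _ c * h) = 0 := by
      simp only [map_sub, map_mul, AlgHom.commutes, c, Algebra.algebraMap_self, RingHom.id_apply]
      field_simp
      ring
    obtain ⟨hD0, hD⟩ := ord_coordDeriv hP (hr0 c) hrc
    intro hWz
    rw [hW c, sub_eq_zero] at hWz
    have e := congrArg (fun s => ord (.some a b hP) (algebraMap _ E.toAffine.FunctionField s)) hWz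
    have hDh : coordDeriv E h ≠ 0 := by
      intro h0
      rw [h0, mul_zero] at hWz
      exact mul_ne_zero hh0 hD0 hWz
    simp only [map_mul] at e
    rw [ord_mul _ (inj _ hh0) (inj _ hD0), ord_mul _ (inj _ (hr0 c)) (inj _ hDh), hD, hPS] at e
    have := ord_coord_nonneg hP (coordDeriv E h)
    omega
  refine (((finite_support_ord (algebraMap _ E.toAffine.FunctionField h)).union
    (finite_support_ord (algebraMap _ E.toAffine.FunctionField W))).union
    (Set.finite_singleton .zero)).subset ?_
  rintro P ⟨c, hc⟩
  cases P with
  | zero => right; rfl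
  | some a b hP =>
    left
    by_contra hn
    simp only [Set.mem_union, Function.mem_support, not_or, not_not] at hn
    have hev := heval hP hn.1
    rw [hsub, ord_div _ (inj _ (hr0 c)) (inj _ hh0), hn.1, sub_zero] at hc
    have h1 := evalAt_coordDeriv_eq_zero hP hc
    have h2 : evalAt hP (g - algebraMap k _ c * h) = 0 := by
      by_contra hne
      rw [ord_coord_eq_zero hP hne] at hc
      omega
    have h3 : evalAt hP W = 0 := by
      rw [hW c, map_sub, map_mul, map_mul, h1, h2]
      ring
    have := ord_coord_pos hP hW0 h3
    omega

end

noncomputable section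

variable {k : Type*} [Field k] {E : WeierstrassCurve k}

/-! ### Functions with prescribed divisor -/

/-- The ideal of regular functions vanishing at a point, the unit ideal for the point at
infinity. -/
def pointIdeal : E.toAffine.Point → Ideal E.toAffine.CoordinateRing
  | .zero => ⊤
  | .some a b _ => Affine.CoordinateRing.XYIdeal E.toAffine a (Polynomial.C b)

theorem pointIdeal_some {a b : k} (h : E.toAffine.Nonsingular a b) :
    pointIdeal (.some a b h) =
      Ideal.span {xCoord E - algebraMap k _ a, yCoord E - algebraMap k _ b} := by
  rw [pointIdeal, Affine.CoordinateRing.XYIdeal, Affine.CoordinateRing.XClass,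
    Affine.CoordinateRing.YClass, map_sub, map_sub, map_sub]
  rfl

theorem exists_toClass_eq [DecidableEq k] (P : E.toAffine.Point) :
    ∃ I : (FractionalIdeal (nonZeroDivisors E.toAffine.CoordinateRing) E.toAffine.FunctionField)ˣ,
      (I : FractionalIdeal (nonZeroDivisors E.toAffine.CoordinateRing) E.toAffine.FunctionField) =
          pointIdeal P ∧
        Affine.Point.toClass P =
          Additive.ofMul (ClassGroup.mk E.toAffine.FunctionField I) := by
  cases P with
  | zero =>
    refine ⟨1, ?_, ?_⟩
    · simp [pointIdeal]
    · rw [map_one]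
      exact Affine.Point.toClass_zero
  | some a b h =>
    exact ⟨Affine.CoordinateRing.XYIdeal' h, Affine.CoordinateRing.XYIdeal'_eq h,
      Affine.Point.toClass_some h⟩

theorem pointValuation_le_of_mem [DecidableEq E.toAffine.Point] {a b : k}
    (h : E.toAffine.Nonsingular a b)
    (Q : E.toAffine.Point) {z : E.toAffine.CoordinateRing} (hz : z ∈ pointIdeal Q) :
    pointValuation (.some a b h) (algebraMap _ _ z) ≤
      exp (-(if .some a b h = Q then 1 else 0 : ℤ)) := by
  split_ifs with hQ
  · subst hQ
    rw [pointIdeal_some, Ideal.mem_span_pair] at hz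
    obtain ⟨u, v, rfl⟩ := hz
    have h0 := pointValuation_chart_le (.some a b h) 0
    have h1 := pointValuation_chart_le (.some a b h) 1
    rw [← algebraMap_coordChart] at h0 h1
    rw [map_add, map_mul, map_mul]
    apply Valuation.map_add_le <;> rw [map_mul]
    · exact (mul_le_mul' (pointValuation_coord_le h u) h0).trans (by rw [one_mul])
    · exact (mul_le_mul' (pointValuation_coord_le h v) h1).trans (by rw [one_mul])
  · simpa using pointValuation_coord_le h z

theorem exists_mem_pointIdeal [DecidableEq E.toAffine.Point] {a b : k}
    (h : E.toAffine.Nonsingular a b)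
    (Q : E.toAffine.Point) : ∃ z ∈ pointIdeal Q, z ≠ 0 ∧
      ord (.some a b h) (algebraMap _ _ z) = if .some a b h = Q then 1 else 0 := by
  have aux : ∀ {c d : k} (h' : E.toAffine.Nonsingular c d) (i : Fin 2),
      coordChart h' i ∈ pointIdeal (.some c d h') ∧ coordChart h' i ≠ 0 := by
    intro c d h' i
    refine ⟨?_, fun e => chart_ne_zero (.some c d h') i (by
      rw [← algebraMap_coordChart, e, map_zero])⟩
    rw [pointIdeal_some]
    apply Ideal.subset_span
    fin_cases i <;> simp [coordChart]
  split_ifs with hQ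
  · subst hQ
    obtain ⟨i, hi⟩ := exists_pointValuation_chart (.some a b h)
    refine ⟨coordChart h i, (aux h i).1, (aux h i).2, ?_⟩
    rw [algebraMap_coordChart]
    exact ord_eq_of_pointValuation hi
  · cases Q with
    | zero => exact ⟨1, trivial, one_ne_zero, by simp⟩
    | some c d h' =>
      have key : ∃ i, evalAt h (coordChart h' i) ≠ 0 := by
        by_contra! hall
        have h0 := hall 0
        have h1 := hall 1
        simp [coordChart, sub_eq_zero] at h0 h1
        subst h0 h1
        exact hQ rfl
      obtain ⟨i, hi⟩ := key
      exact ⟨_, (aux h' i).1, (aux h' i).2, ord_coord_eq_zero h hi⟩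

theorem pointValuation_le_of_mem_sq [DecidableEq E.toAffine.Point] {a b : k}
    (h : E.toAffine.Nonsingular a b)
    (Q : E.toAffine.Point) {z : E.toAffine.CoordinateRing}
    (hz : z ∈ pointIdeal Q * pointIdeal Q) :
    pointValuation (.some a b h) (algebraMap _ _ z) ≤
      exp (-(2 * (if .some a b h = Q then 1 else 0 : ℤ))) := by
  induction hz using Submodule.mul_induction_on' with
  | mem_mul_mem s hs t ht =>
    rw [map_mul, map_mul]
    refine (mul_le_mul' (pointValuation_le_of_mem h Q hs)
      (pointValuation_le_of_mem h Q ht)).trans ?_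
    rw [← exp_add, exp_le_exp]
    omega
  | add s _ t _ hs ht =>
    rw [map_add]
    exact Valuation.map_add_le _ hs ht

/-- Choose z in the ideal of α of least order at the given point. Then x z² = y w with w in the
square of the ideal of γ, and orders can be compared. Each inclusion of ideals gives one inequality
of orders. -/
theorem ord_add_le_of_mem [DecidableEq E.toAffine.Point] {a b : k}
    (h : E.toAffine.Nonsingular a b)
    (α γ : E.toAffine.Point) {x y : E.toAffine.CoordinateRing} (hx : x ≠ 0) (hy : y ≠ 0)
    (hxy : Ideal.span {x} * (pointIdeal α * pointIdeal α) ≤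
      Ideal.span {y} * (pointIdeal γ * pointIdeal γ)) :
    ord (.some a b h) (algebraMap _ _ y) + 2 * (if .some a b h = γ then 1 else 0) ≤
      ord (.some a b h) (algebraMap _ _ x) + 2 * (if .some a b h = α then 1 else 0) := by
  obtain ⟨z, hz, hz0, hzo⟩ := exists_mem_pointIdeal h α
  have inj : ∀ s : E.toAffine.CoordinateRing, s ≠ 0 →
    algebraMap _ E.toAffine.FunctionField s ≠ 0 := fun s hs => by simpa using hs
  have h1 := hxy (Ideal.mul_mem_mul (Ideal.mem_span_singleton_self x) (Ideal.mul_mem_mul hz hz))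
  obtain ⟨w, hw, e⟩ := Ideal.mem_span_singleton_mul.1 h1
  have hw0 : w ≠ 0 := by
    rintro rfl
    rw [mul_zero, eq_comm] at e
    exact mul_ne_zero hx (mul_ne_zero hz0 hz0) e
  have h2 := pointValuation_le_of_mem_sq h γ hw
  have h3 := (le_ord_iff _ (inj w hw0) _).2 h2
  have e2 := congrArg (fun s => ord (.some a b h) (algebraMap _ E.toAffine.FunctionField s)) e
  simp only [map_mul] at e2
  rw [ord_mul _ (inj y hy) (inj w hw0), ord_mul _ (inj x hx) (mul_ne_zero (inj z hz0) (inj z hz0)),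
    ord_mul _ (inj z hz0) (inj z hz0), hzo] at e2
  omega

variable [IsAlgClosed k] [E.IsElliptic]

/-- If `2α = 2γ`, there is a function with divisor `2α - 2γ`. -/
theorem exists_ord_eq_of_add_self_eq [DecidableEq k] {α γ : E.toAffine.Point}
    (h : α + α = γ + γ) : ∃ g : E.toAffine.FunctionField, g ≠ 0 ∧ ∀ P, ord P g =
      2 * (if P = α then 1 else 0) - 2 * (if P = γ then 1 else 0) := by
  have inj : ∀ s : E.toAffine.CoordinateRing, s ≠ 0 →
    algebraMap _ E.toAffine.FunctionField s ≠ 0 := fun s hs => by simpa using hs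
  obtain ⟨I, hI, hIc⟩ := exists_toClass_eq α
  obtain ⟨J, hJ, hJc⟩ := exists_toClass_eq γ
  have hc := congrArg Affine.Point.toClass h
  rw [map_add, map_add, hIc, hJc, ← ofMul_mul, ← ofMul_mul, ← map_mul, ← map_mul] at hc
  have hc' : ClassGroup.mk E.toAffine.FunctionField (I * I) =
      ClassGroup.mk E.toAffine.FunctionField (J * J) := Additive.ofMul.injective hc
  -- Equality of ideal classes means x · I_α² = y · I_γ², so y/x has divisor 2α - 2γ on the affine
  -- part.
  rw [ClassGroup.mk_eq_mk_of_coe_ideal (I' := pointIdeal α * pointIdeal α)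
    (J' := pointIdeal γ * pointIdeal γ) (by simp [hI]) (by simp [hJ])] at hc'
  obtain ⟨x, y, hx, hy, e⟩ := hc'
  have haff : ∀ {a b : k} (hP : E.toAffine.Nonsingular a b), ord (.some a b hP)
      (algebraMap _ E.toAffine.FunctionField y / algebraMap _ _ x) =
      2 * (if .some a b hP = α then 1 else 0) - 2 * (if .some a b hP = γ then 1 else 0) := by
    intro a b hP
    have h1 := ord_add_le_of_mem hP α γ hx hy e.le
    have h2 := ord_add_le_of_mem hP γ α hy hx e.ge
    rw [ord_div _ (inj y hy) (inj x hx)]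
    omega
  set g := algebraMap _ E.toAffine.FunctionField y / algebraMap _ _ x with hg
  have hg0 : g ≠ 0 := div_ne_zero (inj y hy) (inj x hx)
  refine ⟨g, hg0, fun P => ?_⟩
  cases P with
  | some a b hP => exact haff hP
  | zero =>
    -- The order at infinity is forced because both divisors have total degree zero.
    let S : Finset E.toAffine.Point := (finite_support_ord g).toFinset ∪ {α, γ, .zero}
    have hS : (Function.support fun P => ord P g) ⊆ S := by
      intro P hP
      simp [S]
      tauto
    have hsum := finsum_ord hg0
    rw [finsum_eq_sum_of_support_subset _ hS] at hsum
    have hα : α ∈ S := by simp [S]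
    have hγ : γ ∈ S := by simp [S]
    have hz : Affine.Point.zero ∈ S := by simp [S]
    have h2 : ∑ P ∈ S, (ord P g - (2 * (if P = α then 1 else 0) -
        2 * (if P = γ then 1 else 0))) = 0 := by
      rw [Finset.sum_sub_distrib, hsum, Finset.sum_sub_distrib, ← Finset.mul_sum, ← Finset.mul_sum,
        Finset.sum_ite_eq', Finset.sum_ite_eq', if_pos hα, if_pos hγ]
      norm_num
    rw [Finset.sum_eq_single_of_mem _ hz] at h2
    · omega
    · intro P _ hP
      cases P with
      | zero => exact absurd rfl hP
      | some a b hP' => rw [haff hP']; ring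

end

noncomputable section

variable {k : Type*} [Field k] {E : WeierstrassCurve k}

/-! ### Non-generic functions are powers -/

/-- The pair `P, Q` is contained in the divisor of zeros of `f`. -/
def IsZeroPair (f : E.toAffine.FunctionField) (P Q : E.toAffine.Point) : Prop :=
  0 < ord P f ∧ 0 < ord Q f ∧ (P = Q → 2 ≤ ord P f)

theorem exists_zero {f : E.toAffine.FunctionField} (hf : f ≠ 0) {S : Finset E.toAffine.Point}
    (h : ∑ P ∈ S, (ord P f).toNat < degree f) : ∃ P ∉ S, 0 < ord P f := by
  by_contra! hn
  rw [← degree_eq_sum_of_zeros hf hn] at h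
  exact lt_irrefl _ h

theorem exists_isZeroPair {f : E.toAffine.FunctionField} (hf : f ≠ 0) (hd : 2 ≤ degree f) :
    ∃ P Q, IsZeroPair f P Q := by
  obtain ⟨P, -, hP⟩ := exists_zero hf (S := ∅) (by simp; omega)
  by_cases h2 : 2 ≤ ord P f
  · exact ⟨P, P, hP, hP, fun _ => h2⟩
  · obtain ⟨Q, hQ, hQ'⟩ := exists_zero hf (S := {P}) (by simp; omega)
    exact ⟨P, Q, hP, hQ', fun h => absurd h.symm (by simpa using hQ)⟩

/-- Two zero pairs sharing one point but with different partners have different sums. With two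
distinct zeros, degree at least 3 supplies such pairs, from a double zero or from a third zero. -/
theorem exists_unique_zero [DecidableEq k] {f : E.toAffine.FunctionField} (hf : f ≠ 0)
    (hd : 3 ≤ degree f) {s : E.toAffine.Point} (hs : ∀ P Q, IsZeroPair f P Q → P + Q = s) :
    ∃ α, (∀ P ≠ α, ord P f ≤ 0) ∧ α + α = s := by
  classical
  obtain ⟨α, -, hα⟩ := exists_zero hf (S := ∅) (by simp; omega)
  have huniq : ∀ P ≠ α, ord P f ≤ 0 := by
    intro P hPα
    by_contra! hP
    have h1 := hs P α ⟨hP, hα, fun h => absurd h hPα⟩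
    by_cases h2 : 2 ≤ ord α f
    · exact hPα (add_right_cancel (h1.trans (hs α α ⟨hα, hα, fun _ => h2⟩).symm))
    by_cases h3 : 2 ≤ ord P f
    · exact hPα (add_left_cancel ((hs P P ⟨hP, hP, fun _ => h3⟩).trans h1.symm))
    obtain ⟨Q, hQ, hQ'⟩ := exists_zero hf (S := {P, α}) (by
      rw [Finset.sum_pair hPα]
      omega)
    simp only [Finset.mem_insert, Finset.mem_singleton, not_or] at hQ
    have h4 := hs P Q ⟨hP, hQ', fun h => absurd h.symm hQ.1⟩
    have h5 := hs α Q ⟨hα, hQ', fun h => absurd h.symm hQ.2⟩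
    exact hPα (add_right_cancel (h4.trans h5.symm))
  refine ⟨α, huniq, hs α α ⟨hα, hα, fun _ => ?_⟩⟩
  have := degree_eq_sum_of_zeros hf (S := {α}) (by simpa using huniq)
  rw [Finset.sum_singleton] at this
  omega

/-- Once β₁ is fixed, β₂ has to avoid only β₁ and the two points that would make β₁ + β₂ equal to α₁
+ α₂ or γ₁ + γ₂. Hence four points suffice. -/
theorem isGeneric_of_isZeroPair [DecidableEq k] {f : E.toAffine.FunctionField} (hf : f ≠ 0)
    {B : Finset E.toAffine.Point} (hB : 4 ≤ B.card) (hB1 : ∀ β ∈ B, 0 < ord β (f - 1))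
    {α₁ α₂ γ₁ γ₂ : E.toAffine.Point} (hα : IsZeroPair f α₁ α₂) (hγ : IsZeroPair f⁻¹ γ₁ γ₂)
    (hB2 : α₁ + α₂ - γ₁ ∉ B) (hne : α₁ + α₂ ≠ γ₁ + γ₂) : IsGeneric f := by
  classical
  obtain ⟨β₁, hβ₁⟩ := Finset.card_pos.1 (by omega : 0 < B.card)
  have hf1 : f - 1 ≠ 0 := by
    intro h
    have := hB1 β₁ hβ₁
    simp [h] at this
  obtain ⟨β₂, hβ₂⟩ : (B \ {β₁, α₁ + α₂ - β₁, γ₁ + γ₂ - β₁}).Nonempty := by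
    rw [← Finset.card_pos]
    have h1 := Finset.le_card_sdiff {β₁, α₁ + α₂ - β₁, γ₁ + γ₂ - β₁} B
    have h2 := Finset.card_le_three (a := β₁) (b := α₁ + α₂ - β₁) (c := γ₁ + γ₂ - β₁)
    omega
  simp only [Finset.mem_sdiff, Finset.mem_insert, Finset.mem_singleton, not_or] at hβ₂
  obtain ⟨hβ₂B, h1, h2, h3⟩ := hβ₂
  refine ⟨α₁, α₂, β₁, β₂, γ₁, γ₂, ?_, ?_, ?_, ⟨?_, ?_⟩, fun h => h1 h.symm, ⟨?_, ?_, hne⟩, ?_, ?_⟩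
  · rw [zeroMult_eq hf, zeroMult_eq hf]
    exact ⟨Int.lt_toNat.2 hα.1, Int.lt_toNat.2 hα.2.1⟩
  · rw [zeroMult_eq hf1, zeroMult_eq hf1]
    exact ⟨Int.lt_toNat.2 (hB1 _ hβ₁), Int.lt_toNat.2 (hB1 _ hβ₂B)⟩
  · rw [poleMult, poleMult, zeroMult_eq (inv_ne_zero hf), zeroMult_eq (inv_ne_zero hf)]
    exact ⟨Int.lt_toNat.2 hγ.1, Int.lt_toNat.2 hγ.2.1⟩
  · intro h
    have := hα.2.2 h
    rw [zeroMult_eq hf]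
    omega
  · intro h
    have := hγ.2.2 h
    rw [poleMult, zeroMult_eq (inv_ne_zero hf)]
    omega
  · exact fun h => h2 (eq_sub_of_add_eq' h.symm)
  · exact fun h => h3 (eq_sub_of_add_eq' h)
  · exact fun h => hB2 (by rwa [sub_eq_zero.1 h])
  · exact fun h => hB2 (by rwa [sub_eq_zero.1 h])

/-- A function takes at most one value at each point: two would make their non-zero constant
difference vanish there. -/
theorem finite_values (f : E.toAffine.FunctionField) {S : Set E.toAffine.Point} (hS : S.Finite) :
    {c : k | ∃ P ∈ S, 0 < ord P (f - algebraMap k _ c)}.Finite := by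
  have : {c : k | ∃ P ∈ S, 0 < ord P (f - algebraMap k _ c)} =
      ⋃ P ∈ S, {c : k | 0 < ord P (f - algebraMap k _ c)} := by
    ext c
    simp
  rw [this]
  refine hS.biUnion fun P _ => Set.Subsingleton.finite fun c hc c' hc' => ?_
  by_contra hne
  rw [Set.mem_ofPred_eq] at hc hc'
  have e : f - algebraMap k _ c + -(f - algebraMap k _ c') = algebraMap k _ (c' - c) := by
    rw [map_sub]; ring
  have hne' : algebraMap k E.toAffine.FunctionField (c' - c) ≠ 0 := by
    simpa [sub_eq_zero] using fun h => hne h.symm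
  have := le_ord_add (P := P) (n := 1) (by rwa [e]) (Or.inr hc)
    (Or.inr (by rw [ord_neg]; exact hc'))
  rw [e, ord_algebraMap] at this
  omega

variable [IsAlgClosed k] [E.IsElliptic]

/-- The quotient f / h ^ m has no zeros or poles, so it is a constant, and constants have m-th roots
in k. -/
theorem exists_pow_eq {f h : E.toAffine.FunctionField} (hf : f ≠ 0) (hh : h ≠ 0) {m : ℕ}
    (hm : 0 < m) (hord : ∀ P, ord P f = m * ord P h) : ∃ e, f = e ^ m := by
  have hq : ∀ P, 0 ≤ ord P (f / h ^ m) := fun P => by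
    rw [ord_div P hf (pow_ne_zero _ hh), ord_pow, hord, sub_self]
  obtain ⟨c, hc⟩ := eq_algebraMap_of_ord_nonneg hq
  obtain ⟨z, hz⟩ := IsAlgClosed.exists_pow_nat_eq c hm
  refine ⟨algebraMap k _ z * h, ?_⟩
  rw [mul_pow, ← map_pow, hz, ← hc, div_mul_cancel₀ _ (pow_ne_zero _ hh)]

/-- A function of degree at least `4` with one zero `α` and one pole `γ` such that `2α = 2γ` is
a proper power. -/
theorem exists_eq_pow [DecidableEq k] {f : E.toAffine.FunctionField} (hf : f ≠ 0)
    (hd : 4 ≤ degree f) {α γ : E.toAffine.Point} (hα : ∀ P ≠ α, ord P f ≤ 0)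
    (hγ : ∀ P ≠ γ, 0 ≤ ord P f) (h : α + α = γ + γ) :
    ∃ (e : E.toAffine.FunctionField) (m : ℕ), 1 ≤ m ∧ f = e ^ (m + 1) := by
  obtain ⟨g, hg, hgo⟩ := exists_ord_eq_of_add_self_eq h
  have h1 := degree_eq_sum_of_zeros hf (S := {α}) (by simpa using hα)
  have h2 := degree_eq_sum_of_zeros (inv_ne_zero hf) (S := {γ}) (by simpa using hγ)
  rw [degree_inv hf] at h2
  rw [Finset.sum_singleton] at h1 h2
  rw [ord_inv] at h2
  have hne : α ≠ γ := by
    rintro rfl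
    omega
  have hfo : ∀ P, ord P f = degree f * ((if P = α then 1 else 0) - (if P = γ then 1 else 0)) := by
    intro P
    by_cases hPα : P = α
    · subst hPα
      rw [if_pos rfl, if_neg hne]
      omega
    · by_cases hPγ : P = γ
      · subst hPγ
        rw [if_pos rfl, if_neg hPα]
        omega
      · rw [if_neg hPα, if_neg hPγ, sub_zero, mul_zero]
        exact le_antisymm (hα P hPα) (hγ P hPγ)
  -- The divisor of f is deg f · (α - γ) and that of g is 2α - 2γ. If deg f = 2q, then f is a q-th
  -- power, with q ≥ 2 because the degree is at least 4. If deg f = 2q + 1, then f / g ^ q has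
  -- divisor α - γ and f is a (2q + 1)-th power; this case need not be ruled out.
  obtain ⟨q, hq | hq⟩ := Nat.even_or_odd' (degree f)
  · obtain ⟨e, he⟩ := exists_pow_eq hf hg (m := q - 1 + 1) (by omega) fun P => by
      rw [hfo, hgo, hq, Nat.sub_add_cancel (by omega)]
      push_cast
      ring
    exact ⟨e, q - 1, by omega, he⟩
  · have hne0 : f / g ^ q ≠ 0 := div_ne_zero hf (pow_ne_zero _ hg)
    obtain ⟨e, he⟩ := exists_pow_eq hf hne0 (m := 2 * q + 1) (by omega) fun P => by
      rw [ord_div P hf (pow_ne_zero _ hg), ord_pow, hfo, hgo, hq]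
      push_cast
      ring
    exact ⟨e, 2 * q, by omega, he⟩

/-- A function of degree `n + 1` whose fibre over `1` contains four points in general position is
generic up to functions of lower degree. -/
theorem symbol_mem_sup [DecidableEq k] {n : ℕ} (hn : 3 ≤ n)
    (h : PreBlochGen E.toAffine.FunctionField) (hd : degree h.1 = n + 1)
    {B : Finset E.toAffine.Point} (hB : 4 ≤ B.card) (hB1 : ∀ β ∈ B, 0 < ord β (h.1 - 1))
    (hB2 : ∀ α₁ α₂ γ, ord α₁ h.1 ≠ 0 → ord α₂ h.1 ≠ 0 → ord γ h.1 ≠ 0 → α₁ + α₂ - γ ∉ B) :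
    PreBloch.symbol h ∈ filtration E n ⊔ genericSubgroup E (n + 1) := by
  by_cases hg : IsGeneric h.1
  · exact AddSubgroup.mem_sup_right (AddSubgroup.subset_closure ⟨h, hg, hd, rfl⟩)
  have hh0 := h.2.1
  -- With `B` in general position, only the condition α₁ + α₂ ≠ γ₁ + γ₂ can fail, so it fails for
  -- all pairs.
  have hsum : ∀ α₁ α₂ γ₁ γ₂, IsZeroPair h.1 α₁ α₂ → IsZeroPair h.1⁻¹ γ₁ γ₂ →
      α₁ + α₂ = γ₁ + γ₂ := by
    intro α₁ α₂ γ₁ γ₂ hα hγ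
    by_contra hne
    refine hg (isGeneric_of_isZeroPair hh0 hB hB1 hα hγ (hB2 _ _ _ hα.1.ne' hα.2.1.ne' ?_) hne)
    have := hγ.1
    rw [ord_inv] at this
    omega
  have hd' : degree h.1⁻¹ = n + 1 := by rw [degree_inv hh0, hd]
  obtain ⟨γ₁, γ₂, hγ⟩ := exists_isZeroPair (inv_ne_zero hh0) (by omega)
  obtain ⟨α, hα, hαs⟩ := exists_unique_zero hh0 (by omega) fun P Q hPQ => hsum P Q γ₁ γ₂ hPQ hγ
  obtain ⟨α₁, α₂, hα'⟩ := exists_isZeroPair hh0 (by omega)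
  obtain ⟨γ, hγ', hγs⟩ := exists_unique_zero (inv_ne_zero hh0) (by omega) fun P Q hPQ =>
    (hsum α₁ α₂ P Q hα' hPQ).symm
  obtain ⟨e, m, hm, he⟩ := exists_eq_pow hh0 (by omega) hα
    (fun P hP => by have := hγ' P hP; rw [ord_inv] at this; omega)
    (by rw [hαs, hγs, hsum _ _ _ _ hα' hγ])
  apply AddSubgroup.mem_sup_left
  have he0 : e ≠ 0 := by
    rintro rfl
    exact hh0 (by rw [he]; simp)
  have hde : (m + 1) * degree e = n + 1 := by rw [← degree_pow he0, ← he, hd]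
  have hpos : 0 < degree e := by
    by_contra h0
    rw [Nat.eq_zero_of_not_pos h0] at hde
    omega
  refine symbol_pow_mem hm hpos h he ?_
  nlinarith

variable [CharZero k]

theorem symbol_mem_of_degree_eq [DecidableEq k] {n : ℕ} (hn : 3 ≤ n)
    (f : PreBlochGen E.toAffine.FunctionField) (hd : degree f.1 = n + 1) :
    PreBloch.symbol f ∈ filtration E n ⊔ genericSubgroup E (n + 1) := by
  obtain ⟨f, hf0, hf1⟩ := f
  change degree f = n + 1 at hd
  have hconst : ∀ c, f ≠ algebraMap k _ c := by
    rintro c rfl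
    rw [degree_algebraMap c (by rintro rfl; simp at hf0)] at hd
    omega
  -- `T` contains all zeros and poles of each of the three companion functions in the five-term
  -- relation.
  let T : Set E.toAffine.Point :=
    (Function.support fun P => ord P f) ∪ (Function.support fun P => ord P (1 - f))
  have hT : T.Finite := (finite_support_ord f).union (finite_support_ord (1 - f))
  have hT2 : {P | ∃ α₁ ∈ T, ∃ α₂ ∈ T, ∃ γ ∈ T, P = α₁ + α₂ - γ}.Finite := by
    refine ((hT.prod (hT.prod hT)).image fun x => x.1 + x.2.1 - x.2.2).subset ?_
    rintro _ ⟨α₁, h1, α₂, h2, γ, h3, rfl⟩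
    exact ⟨(α₁, α₂, γ), ⟨h1, h2, h3⟩, rfl⟩
  -- The field k is infinite, so `c` can avoid 0, 1 and the values of `f` at ramification points and
  -- at the points α₁ + α₂ - γ.
  obtain ⟨c, hc⟩ := (((finite_values f ((finite_ramification hconst).union hT2)).union
    (Set.finite_singleton (0 : k))).union (Set.finite_singleton (1 : k))).exists_notMem
  simp only [Set.mem_union, Set.mem_singleton_iff, not_or] at hc
  obtain ⟨⟨hc, hc0⟩, hc1⟩ := hc
  have hfc0 : f - algebraMap k _ c ≠ 0 := sub_ne_zero.2 (hconst c)
  let B := (finite_support_ord (f - algebraMap k _ c)).toFinset.filter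
    fun P => 0 < ord P (f - algebraMap k _ c)
  have hBpos : ∀ β ∈ B, 0 < ord β (f - algebraMap k _ c) := fun β hβ => (Finset.mem_filter.1 hβ).2
  have hBgood : ∀ β ∈ B, β ∉ ({P | ∃ c, 2 ≤ ord P (f - algebraMap k _ c)} ∪
      {P | ∃ α₁ ∈ T, ∃ α₂ ∈ T, ∃ γ ∈ T, P = α₁ + α₂ - γ} : Set E.toAffine.Point) :=
    fun β hβ hmem => hc ⟨β, hmem, hBpos β hβ⟩
  -- Every zero of f - c is simple, so the fibre has as many points as the degree.
  have hBcard : B.card = n + 1 := by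
    rw [← hd, ← degree_sub_algebraMap c hf0 hfc0, degree_eq_sum_of_zeros hfc0 (S := B),
      Finset.card_eq_sum_ones]
    · refine Finset.sum_congr rfl fun β hβ => ?_
      have h1 := hBpos β hβ
      have h2 : ¬ 2 ≤ ord β (f - algebraMap k _ c) := fun h2 => hBgood β hβ (Or.inl ⟨c, h2⟩)
      omega
    · intro P hP
      by_contra! hpos
      exact hP (Finset.mem_filter.2 ⟨by simpa using hpos.ne', hpos⟩)
  have hBf : ∀ β ∈ B, ord β f = 0 := by
    intro β hβ
    have hca : algebraMap k E.toAffine.FunctionField c ≠ 0 := by simpa using hc0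
    have := ord_add_eq (P := β) hca (g := f - algebraMap k _ c)
      (Or.inr (by rw [ord_algebraMap]; exact hBpos β hβ))
    rwa [add_sub_cancel, ord_algebraMap] at this
  have key : ∀ h : PreBlochGen E.toAffine.FunctionField, degree h.1 = n + 1 →
      (∀ β ∈ B, 0 < ord β (h.1 - 1)) → (∀ P, ord P h.1 ≠ 0 → P ∈ T) →
      PreBloch.symbol h ∈ filtration E n ⊔ genericSubgroup E (n + 1) := by
    intro h hh hh1 hhT
    refine symbol_mem_sup hn h hh (B := B) (by omega) hh1 fun α₁ α₂ γ h1 h2 h3 hmem => ?_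
    exact hBgood _ hmem (Or.inr ⟨α₁, hhT _ h1, α₂, hhT _ h2, γ, hhT _ h3, rfl⟩)
  have hC : ∀ {a : k}, a ≠ 0 → algebraMap k E.toAffine.FunctionField a ≠ 0 := fun ha => by
    simpa using ha
  have hca := hC hc0
  have hc1' : c - 1 ≠ 0 := sub_ne_zero.2 hc1
  have hca1 := hC hc1'
  rw [map_sub, map_one] at hca1
  have hf1' : f - 1 ≠ 0 := sub_ne_zero.2 hf1
  have hfi1 : f⁻¹ - 1 ≠ 0 := sub_ne_zero.2 fun h => hf1 (inv_eq_one.1 h)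
  let y : PreBlochGen E.toAffine.FunctionField :=
    ⟨algebraMap k _ c, hca, fun h => hca1 (sub_eq_zero.2 h)⟩
  have hxy : (⟨f, hf0, hf1⟩ : PreBlochGen E.toAffine.FunctionField) ≠ y := fun h =>
    hconst c (congrArg Subtype.val h)
  -- For each companion h below, h - 1 is f - c up to a constant factor and possibly division by
  -- `f`, which has order 0 on `B`. Hence h equals 1 on `B`.
  apply PreBloch.symbol_left_mem _ y hxy
  · apply AddSubgroup.mem_sup_left
    apply symbol_mem_filtration
    rw [degree_algebraMap c hc0]
    omega
  · have e : (PreBlochGen.quot ⟨f, hf0, hf1⟩ y hxy).1 = algebraMap k _ c * f⁻¹ :=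
      div_eq_mul_inv _ _
    apply key <;> rw [e]
    · rw [degree_algebraMap_mul hc0 (inv_ne_zero hf0), degree_inv hf0, hd]
    · intro β hβ
      have e2 : algebraMap k _ c * f⁻¹ - 1 = -((f - algebraMap k _ c) / f) := by
        field_simp
        ring
      rw [e2, ord_neg, ord_div _ hfc0 hf0, hBf β hβ, sub_zero]
      exact hBpos β hβ
    · intro P hP
      rw [ord_mul P hca (inv_ne_zero hf0), ord_algebraMap, ord_inv] at hP
      left
      rw [Function.mem_support]
      omega
  · have e : (PreBlochGen.oneSubQuot ⟨f, hf0, hf1⟩ y hxy).1 =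
        algebraMap k _ (c - 1)⁻¹ * (f - algebraMap k _ 1) := by
      change (1 - f) / (1 - algebraMap k _ c) = _
      rw [map_inv₀, map_sub, map_one, ← neg_sub f 1, ← neg_sub (algebraMap k _ c) 1, neg_div_neg_eq,
        div_eq_inv_mul]
    have hne : f - algebraMap k _ 1 ≠ 0 := by rwa [map_one]
    apply key <;> rw [e]
    · rw [degree_algebraMap_mul (inv_ne_zero hc1') hne, degree_sub_algebraMap 1 hf0 hne, hd]
    · intro β hβ
      have e2 : algebraMap k _ (c - 1)⁻¹ * (f - algebraMap k _ 1) - 1 =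
          algebraMap k _ (c - 1)⁻¹ * (f - algebraMap k _ c) := by
        rw [map_inv₀, map_sub, map_one]
        field_simp
        ring
      rw [e2, ord_mul _ (hC (inv_ne_zero hc1')) hfc0, ord_algebraMap, zero_add]
      exact hBpos β hβ
    · intro P hP
      rw [ord_mul P (hC (inv_ne_zero hc1')) hne, ord_algebraMap, map_one, ord_sub_comm] at hP
      right
      rw [Function.mem_support]
      omega
  · have hci : c⁻¹ - 1 ≠ 0 := sub_ne_zero.2 fun h => hc1 (inv_eq_one.1 h)
    have hcia := hC hci
    rw [map_sub, map_one, map_inv₀] at hcia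
    have e : (PreBlochGen.oneSubInvQuot ⟨f, hf0, hf1⟩ y hxy).1 =
        algebraMap k _ (c⁻¹ - 1)⁻¹ * (f⁻¹ - algebraMap k _ 1) := by
      change (1 - f⁻¹) / (1 - (algebraMap k _ c)⁻¹) = _
      rw [map_inv₀, map_sub, map_one, map_inv₀, ← neg_sub f⁻¹ 1,
        ← neg_sub (algebraMap k _ c)⁻¹ 1, neg_div_neg_eq, div_eq_inv_mul]
    have hne : f⁻¹ - algebraMap k _ 1 ≠ 0 := by rwa [map_one]
    apply key <;> rw [e]
    · rw [degree_algebraMap_mul (inv_ne_zero hci) hne,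
        degree_sub_algebraMap 1 (inv_ne_zero hf0) hne, degree_inv hf0, hd]
    · intro β hβ
      have e2 : algebraMap k _ (c⁻¹ - 1)⁻¹ * (f⁻¹ - algebraMap k _ 1) - 1 =
          algebraMap k _ ((c - 1)⁻¹) * ((f - algebraMap k _ c) / f) := by
        have h3 : (c⁻¹ - 1)⁻¹ = - c * (c - 1)⁻¹ := by
          rw [inv_eq_iff_eq_inv, mul_inv, inv_inv]
          field_simp
          ring
        rw [h3, map_mul, map_inv₀, map_sub, map_one, map_neg]
        field_simp
        ring
      rw [e2, ord_mul _ (hC (inv_ne_zero hc1')) (div_ne_zero hfc0 hf0), ord_algebraMap, zero_add,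
        ord_div _ hfc0 hf0, hBf β hβ, sub_zero]
      exact hBpos β hβ
    · intro P hP
      have e3 : f⁻¹ - 1 = (1 - f) / f := by
        field_simp
      rw [ord_mul P (hC (inv_ne_zero hci)) hne, ord_algebraMap, map_one, e3,
        ord_div P (sub_ne_zero.2 hf1.symm) hf0] at hP
      change P ∈ _ ∪ _
      rw [Set.mem_union, Function.mem_support, Function.mem_support]
      omega

end

end EllipticFunction

theorem proposition3 {k : Type*} [Field k] [IsAlgClosed k] [CharZero k] [DecidableEq k]
    (E : WeierstrassCurve k) [E.IsElliptic] (n : ℕ) (hn : 3 ≤ n) :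
    EllipticFunction.filtration E (n + 1) =
      EllipticFunction.filtration E n ⊔ EllipticFunction.genericSubgroup E (n + 1) := by
  apply le_antisymm
  · refine (AddSubgroup.closure_le _).2 ?_
    rintro _ ⟨f, hf, rfl⟩
    rcases Nat.lt_or_ge n (EllipticFunction.degree f.1) with h | h
    · exact EllipticFunction.symbol_mem_of_degree_eq hn f (by omega)
    · exact AddSubgroup.mem_sup_left (EllipticFunction.symbol_mem_filtration h)
  · refine sup_le ((AddSubgroup.closure_le _).2 ?_) ((AddSubgroup.closure_le _).2 ?_)
    · rintro _ ⟨f, hf, rfl⟩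
      exact EllipticFunction.symbol_mem_filtration (hf.trans n.le_succ)
    · rintro _ ⟨f, -, hf, rfl⟩
      exact EllipticFunction.symbol_mem_filtration hf.le
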